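/- Conventions. Lattices are nonempty and are viewed as algebras of type $\{\vee,\wedge\}$. For a lattice $L$, $\Theta_L(x,y)$ is the least congruence identifying $x$ and $y$, and $\operatorname{Con_c}L$ is the $(\vee,0)$-semilattice of finitely generated congruences of $L$. A *pregamp* (of type $\{\vee,\wedge\}$) is a triple $(A,\delta,S)$ with $A$ a partial algebra, $S$ a $(\vee,0)$-semilattice and $\delta\colon A^2\to S$ such that $\delta(x,y)=0\iff x=y$, $\delta(x,y)=\delta(y,x)$, $\delta(x,y)\le\delta(x,z)\vee\delta(z,y)$, and $\delta(\ell(x_0,x_1),\ell(y_0,y_1))\le\delta(x_0,y_0)\vee\delta(x_1,y_1)$ whenever $\ell\in\{\vee,\wedge\}$ and both values of $\ell$ are defined. A morphism $(A,\delta,S)\to(A',\delta',S')$ is a pair $(f,\tilde f)$ of a morphism $f\colon A\to A'$ of partial algebras and a $(\vee,0)$-homomorphism $\tilde f\colon S\to S'$ with $\delta'(f(x),f(y))=\tilde f(\delta(x,y))$. For an ideal $I$ of $S$, $A/I$ is the quotient of $A$ by the equivalence $\delta(x,y)\in I$, an operation being defined at a pair of classes iff it is defined at some pair of representatives. A *gamp*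 is a quadruple $\mathbf A=(A^*,A,\delta,S)$ with $(A,\delta,S)$ a pregamp and $A^*$ a partial subalgebra of $A$ (a subset, with possibly smaller domains of definition of the operations); a morphism of gamps is a morphism $(f,\tilde f)$ of pregamps such that $f(A^*)$ is a partial subalgebra of the starred part of the target. It is a *gamp of lattices* if for every ideal $I$ of $S$ the partial algebra $A/I$ satisfies every lattice identity at each valuation for which both sides are defined. A gamp of lattices is *congruence $n$-permutable* if for all $x_0,\dots,x_n\in A^*$ there are $y_0,\dots,y_n\in A$ with $y_i\wedge y_j=y_j\wedge y_i=y_i$ for $i\le j\le n$, $y_0=x_0\wedge x_n=x_n\wedge x_0$, $y_n=x_0\vee x_n=x_n\vee x_0$ (all these being defined in $A$), $\delta(y_k,y_{k+1})\le\bigvee_{i<n,\ i\text{ even}}\delta(x_i,x_{i+1})$ for odd $k<n$, and $\delta(y_k,y_{k+1})\le\bigvee_{i<n,\ i\text{ odd}}\delta(x_i,x_{i+1})$ for even $k<n$. A diagram of gamps indexed by a poset $P$ is *operational* if for all $p<q$ both operations are defined in $B_q$ at all pairs of elements of $f_{p,q}(B_p)\cup B_q^*$. Let $\mathrm{PGGL}(A^*,A,\delta,S)=(A^*,\delta,S)$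 and $\mathrm{PGA}(L)=(L,\Theta_L,\operatorname{Con_c}L)$, with the obvious actions on morphisms. A finite subset $V$ of a poset $X$ is a *kernel* if for every $x\in X$ there is a largest $v\in V$ with $v\le x$, denoted $V\cdot x$; $X$ is *supported* if every finite subset is contained in a kernel. A *norm-covering* of a poset $P$ is a supported poset $X$ with an isotone map $\partial\colon X\to P$. An ideal (nonempty directed lower subset) $\mathbf x$ of $X$ is *sharp* if $\{\partial x: x\in\mathbf x\}$ has a largest element, denoted $\partial\mathbf x$. An *$\aleph_0$-lifter* of $P$ is a pair $(X,\mathbf X)$ with $X$ a norm-covering of $P$ and $\mathbf X$ a set of sharp ideals of $X$, such that, with $\mathbf X^{=}=\{\mathbf x\in\mathbf X:\partial\mathbf x\text{ not maximal in }P\}$: each $\mathbf x\in\mathbf X^{=}$ contains only finitely many members of $\mathbf X$; and for every map $S$ from $\mathbf X^{=}$ to the finite subsets of $X$ there is an isotone $\sigma\colon P\to\mathbf X$ with $\partial\sigma(p)=p$ for all $p$ and $S(\sigma(p))\cap\sigma(q)\subseteq\sigma(p)$ for all $p<q$. For a $P$-indexed diagram $\vec A=(A_p,f_{p,q})$ of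 lattices, the condensate $\mathrm F(X)\otimes\vec A$ is the sublattice of $\prod_{x\in X}A_{\partial x}$ of all $t$ for which there is a kernel $V$ of $X$ with $t_x=f_{\partial(V\cdot x),\partial x}(t_{V\cdot x})$ for all $x\in X$ (the directed colimit, over the kernels $V$, of the finite products $\prod_{v\in V}A_{\partial v}$). **Lemma.** Let $n\ge2$, let $\mathcal V$ be a variety of lattices, let $(X,\mathbf X)$ be an $\aleph_0$-lifter of a poset $P$, and let $\vec A=(A_p,f_{p,q})_{p\le q\text{ in }P}$ be a diagram in $\mathcal V$ such that $A_p$ is finite for each non-maximal $p\in P$. Let $B$ be a congruence $n$-permutable lattice (that is, $\alpha\circ\beta\circ\alpha\circ\cdots=\beta\circ\alpha\circ\beta\circ\cdots$, with $n$ factors on each side, for all congruences $\alpha,\beta$ of $B$). If $B$ is a congruence-preserving extension of $\mathrm F(X)\otimes\vec A$ (that is, an extension such that every congruence of $\mathrm F(X)\otimes\vec A$ is the restriction of exactly one congruence of $B$), then there is an operational $P$-indexed diagram $\vec{\mathbf B}$ of congruence $n$-permutable gamps of lattices such that the diagrams $\mathrm{PGGL}\circ\vec{\mathbf B}$ and $\mathrm{PGA}\circ\vec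 A$ of pregamps are naturally isomorphic. -/

import Mathlib

open CategoryTheory

universe u v w

namespace CondLift

/-! ### Congruences of lattices -/

section Congruences

variable {L : Type u} [Lattice L]

theorem latticeCon_ext {c d : LatticeCon L} (h : ∀ x y, c.r x y ↔ d.r x y) : c = d := by
  cases c with
  | mk s _ _ =>
    cases d with
    | mk t _ _ =>
      have hst : s = t := Setoid.ext h
      subst hst
      rfl

/-- Congruences of a lattice are ordered by inclusion. -/
instance : PartialOrder (LatticeCon L) where
  le c d := ∀ ⦃x y : L⦄, c.r x y → d.r x y
  le_refl _ _ _ h := h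
  le_trans _ _ _ h₁ h₂ _ _ h := h₂ (h₁ h)
  le_antisymm _ _ h₁ h₂ := latticeCon_ext fun _ _ => ⟨@h₁ _ _, @h₂ _ _⟩

instance : InfSet (LatticeCon L) where
  sInf S :=
    { r := fun x y => ∀ c ∈ S, c.r x y
      iseqv := ⟨fun x c _ => c.iseqv.refl x, fun h c hc => c.iseqv.symm (h c hc),
        fun h₁ h₂ c hc => c.iseqv.trans (h₁ c hc) (h₂ c hc)⟩
      inf := fun h₁ h₂ d hd => d.inf (h₁ d hd) (h₂ d hd)
      sup := fun h₁ h₂ c hc => c.sup (h₁ c hc) (h₂ c hc) }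

theorem isGLB_sInf_latticeCon (S : Set (LatticeCon L)) : IsGLB S (sInf S) :=
  ⟨fun _ hc _ _ h => h _ hc, fun _ hd _ _ h c hc => hd hc h⟩

/-- The complete lattice `Con L` of all congruences of `L`. -/
instance : CompleteLattice (LatticeCon L) :=
  completeLatticeOfInf _ isGLB_sInf_latticeCon

/-- `Θ(x, y)`: the smallest congruence identifying `x` and `y`. -/
def principalCon (x y : L) : LatticeCon L := sInf {c | c.r x y}

theorem principalCon_le_iff {x y : L} {c : LatticeCon L} : principalCon x y ≤ c ↔ c.r x y :=
  ⟨fun h => h fun _ hd => hd, fun h => sInf_le h⟩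

theorem principalCon_rel (x y : L) : (principalCon x y).r x y :=
  principalCon_le_iff.1 le_rfl

/-- A congruence is finitely generated if it is a finite join of principal congruences. -/
def IsFGCon (c : LatticeCon L) : Prop :=
  ∃ s : Finset (L × L), c = s.sup fun p => principalCon p.1 p.2

theorem isFGCon_principal (x y : L) : IsFGCon (principalCon x y) :=
  ⟨{(x, y)}, by simp⟩

theorem isFGCon_bot : IsFGCon (⊥ : LatticeCon L) := ⟨∅, by simp⟩

theorem IsFGCon.sup {c d : LatticeCon L} (hc : IsFGCon c) (hd : IsFGCon d) : IsFGCon (c ⊔ d) := by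
  classical
  obtain ⟨s, rfl⟩ := hc
  obtain ⟨t, rfl⟩ := hd
  exact ⟨s ∪ t, by rw [Finset.sup_union]⟩

/-- The image of a congruence under a homomorphism: the congruence generated by the image. -/
def mapCon {M : Type w} [Lattice M] (f : LatticeHom L M) (c : LatticeCon L) : LatticeCon M :=
  sInf {d | ∀ x y, c.r x y → d.r (f x) (f y)}

/-- The inverse image of a congruence under a homomorphism. -/
def comapCon {M : Type w} [Lattice M] (f : LatticeHom L M) (d : LatticeCon M) : LatticeCon L where
  r x y := d.r (f x) (f y)
  iseqv := ⟨fun x => d.iseqv.refl (f x), fun h => d.iseqv.symm h, fun h₁ h₂ => d.iseqv.trans h₁ h₂⟩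
  inf h₁ h₂ := by
    rw [map_inf, map_inf]
    exact d.inf h₁ h₂
  sup h₁ h₂ := by
    rw [map_sup, map_sup]
    exact d.sup h₁ h₂

theorem gc_mapCon {M : Type w} [Lattice M] (f : LatticeHom L M) :
    GaloisConnection (mapCon f) (comapCon f) := fun _ _ =>
  ⟨fun h _ _ hxy => h fun _ he => he _ _ hxy, fun h => sInf_le fun _ _ hxy => h hxy⟩

theorem mapCon_principalCon {M : Type w} [Lattice M] (f : LatticeHom L M) (x y : L) :
    mapCon f (principalCon x y) = principalCon (f x) (f y) :=
  eq_of_forall_ge_iff fun d => by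
    rw [gc_mapCon f, principalCon_le_iff, principalCon_le_iff]
    rfl

theorem IsFGCon.map {M : Type w} [Lattice M] (f : LatticeHom L M) {c : LatticeCon L}
    (hc : IsFGCon c) : IsFGCon (mapCon f c) := by
  classical
  obtain ⟨s, rfl⟩ := hc
  induction s using Finset.induction_on with
  | empty => simpa [(gc_mapCon f).l_bot] using isFGCon_bot
  | insert p s _ ih =>
    rw [Finset.sup_insert, (gc_mapCon f).l_sup, mapCon_principalCon]
    exact (isFGCon_principal _ _).sup ih

variable (L) in
/-- `Con_c L`: the join-semilattice with zero of all compact, that is, finitely generated,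
congruences of `L`. -/
def ConC : Type u := {c : LatticeCon L // IsFGCon c}

instance : SemilatticeSup (ConC L) :=
  Subtype.semilatticeSup (P := IsFGCon (L := L)) fun _ _ h₁ h₂ => h₁.sup h₂

instance : OrderBot (ConC L) where
  bot := ⟨⊥, isFGCon_bot⟩
  bot_le c := (bot_le : (⊥ : LatticeCon L) ≤ c.1)

/-- `Θ(x, y)` as a compact congruence. -/
def theta (x y : L) : ConC L := ⟨principalCon x y, isFGCon_principal x y⟩

/-- `Con_c f`, for a homomorphism `f`. -/
def mapConC {M : Type w} [Lattice M] (f : LatticeHom L M) : SupBotHom (ConC L) (ConC M) where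
  toFun c := ⟨mapCon f c.1, c.2.map f⟩
  map_sup' c d := Subtype.ext ((gc_mapCon f).l_sup (a₁ := c.1) (a₂ := d.1))
  map_bot' := Subtype.ext (gc_mapCon f).l_bot

/-- `altComp n α β = α ∘ β ∘ α ∘ ⋯`, with `n` factors. -/
def altComp : ℕ → LatticeCon L → LatticeCon L → L → L → Prop
  | 0, _, _ => Eq
  | n + 1, α, β => Relation.Comp α.r (altComp n β α)

variable (L) in
/-- `L` is congruence `n`-permutable. -/
def CongruencePermutable (n : ℕ) : Prop :=
  ∀ α β : LatticeCon L, altComp n α β = altComp n β α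

/-- `i` exhibits `M` as a congruence-preserving extension of `L`: it is an embedding, and every
congruence of `L` is the restriction of exactly one congruence of `M`. -/
def IsCongruencePreservingExtension {M : Type w} [Lattice M] (i : LatticeHom L M) : Prop :=
  Function.Injective i ∧ ∀ c : LatticeCon L, ∃! d : LatticeCon M, comapCon i d = c

end Congruences

/-! ### Terms, identities and varieties of lattices -/

/-- The similarity type of lattices: two binary operations. -/
inductive LatOp : Type
  | sup
  | inf

/-- The interpretation of the operation symbols in a lattice. -/
def LatOp.eval {L : Type u} [Lattice L] : LatOp → L → L → L
  | .sup, x, y => x ⊔ y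
  | .inf, x, y => x ⊓ y

/-- Lattice terms in countably many variables. -/
inductive LatTerm : Type
  | var (i : ℕ)
  | app (l : LatOp) (s t : LatTerm)

/-- The value of a term in a lattice. -/
def LatTerm.eval {L : Type u} [Lattice L] (x : ℕ → L) : LatTerm → L
  | .var i => x i
  | .app l s t => l.eval (s.eval x) (t.eval x)

/-- A variety of lattices, given by a set of defining identities. -/
structure LatticeVariety : Type where
  eqs : Set (LatTerm × LatTerm)

/-- Membership of a lattice in a variety. -/
def LatticeVariety.Mem (V : LatticeVariety) (L : Type u) [Lattice L] : Prop :=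
  ∀ e ∈ V.eqs, ∀ x : ℕ → L, e.1.eval x = e.2.eval x

/-- The variety of all lattices. -/
def LatticeVariety.all : LatticeVariety := ⟨∅⟩

/-- The identity `s = t` holds in every member of `V`. -/
def LatticeVariety.Identity (V : LatticeVariety) (s t : LatTerm) : Prop :=
  ∀ (L : Type u) [Lattice L], V.Mem L → ∀ x : ℕ → L, s.eval x = t.eval x

/-! ### Partial algebras -/

/-- Partial algebras of the similarity type of lattices. `(op l x y).Dom` says that
`l(x, y)` is defined, and `z ∈ op l x y` says that `l(x, y)` is defined and equal to `z`. -/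
class PartialAlg (A : Type u) where
  op : LatOp → A → A → Part A

/-- A lattice, as a partial algebra with all operations everywhere defined. -/
@[reducible] def PartialAlg.ofLattice (L : Type u) [Lattice L] : PartialAlg L where
  op l x y := Part.some (l.eval x y)

/-- The (possibly undefined) value of a term in a partial algebra. -/
def LatTerm.peval {A : Type u} [PartialAlg A] (x : ℕ → A) : LatTerm → Part A
  | .var i => Part.some (x i)
  | .app l s t => (s.peval x).bind fun a => (t.peval x).bind fun b => PartialAlg.op l a b

/-- A partial algebra satisfies `s = t` if both sides agree whenever both are defined. -/
def PartialAlg.Satisfies {A : Type u} (P : PartialAlg A) (s t : LatTerm) : Prop :=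
  ∀ x : ℕ → A, ∀ a ∈ s.peval x, ∀ b ∈ t.peval x, a = b

/-- A partial subalgebra of `A`: a subset with smaller domains of definition for the operations,
closed under the operations so restricted. -/
structure PartialSubalg (A : Type u) [PartialAlg A] where
  carrier : Set A
  dom : LatOp → A → A → Prop
  left_mem : ∀ {l x y}, dom l x y → x ∈ carrier
  right_mem : ∀ {l x y}, dom l x y → y ∈ carrier
  dom_sub : ∀ {l x y}, dom l x y → (PartialAlg.op l x y).Dom
  get_mem : ∀ {l x y} (h : dom l x y), (PartialAlg.op l x y).get (dom_sub h) ∈ carrier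

/-- The partial algebra structure of a partial subalgebra. -/
@[reducible] def PartialSubalg.palg {A : Type u} [PartialAlg A] (S : PartialSubalg A) :
    PartialAlg {x // x ∈ S.carrier} where
  op l x y := ⟨S.dom l x y, fun h => ⟨(PartialAlg.op l x.1 y.1).get (S.dom_sub h), S.get_mem h⟩⟩

theorem PartialSubalg.mem_op {A : Type u} [PartialAlg A] (S : PartialSubalg A) {l : LatOp}
    {x y z : {a // a ∈ S.carrier}} :
    z ∈ S.palg.op l x y ↔ S.dom l x y ∧ z.1 ∈ PartialAlg.op l x.1 y.1 := by
  constructor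
  · rintro ⟨h, rfl⟩
    exact ⟨h, Part.get_mem _⟩
  · rintro ⟨h, hz⟩
    exact ⟨h, Subtype.ext (Part.get_eq_of_mem hz _)⟩

/-! ### Pregamps -/

/-- Pregamps (of the similarity type of lattices): a partial algebra with a distance, valued in a
join-semilattice with zero, that is compatible with the operations. -/
structure Pregamp : Type (u + 1) where
  carrier : Type u
  [palg : PartialAlg carrier]
  sem : Type u
  [semSup : SemilatticeSup sem]
  [semBot : OrderBot sem]
  dist : carrier → carrier → sem
  dist_eq_bot : ∀ x y, dist x y = ⊥ ↔ x = y
  dist_comm : ∀ x y, dist x y = dist y x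
  dist_triangle : ∀ x y z, dist x y ≤ dist x z ⊔ dist z y
  dist_op : ∀ (l : LatOp) (x₀ x₁ y₀ y₁ x y : carrier), x ∈ PartialAlg.op l x₀ x₁ →
    y ∈ PartialAlg.op l y₀ y₁ → dist x y ≤ dist x₀ y₀ ⊔ dist x₁ y₁

attribute [instance] Pregamp.palg Pregamp.semSup Pregamp.semBot

namespace Pregamp

/-- Morphisms of pregamps. -/
@[ext] structure Hom (A B : Pregamp.{u}) where
  toFun : A.carrier → B.carrier
  semHom : SupBotHom A.sem B.sem
  map_op : ∀ (l : LatOp) (x y z : A.carrier), z ∈ PartialAlg.op l x y →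
    toFun z ∈ PartialAlg.op l (toFun x) (toFun y)
  map_dist : ∀ x y, B.dist (toFun x) (toFun y) = semHom (A.dist x y)

/-- The category of pregamps. -/
instance : Category Pregamp.{u} where
  Hom := Hom
  id A := ⟨id, SupBotHom.id _, fun _ _ _ _ h => h, fun _ _ => rfl⟩
  comp f g := ⟨g.toFun ∘ f.toFun, g.semHom.comp f.semHom,
    fun l x y z h => g.map_op l _ _ _ (f.map_op l x y z h),
    fun x y => by
      change _ = g.semHom (f.semHom _)
      rw [← f.map_dist, ← g.map_dist]
      rfl⟩

variable (A : Pregamp.{u}) (I : Order.Ideal A.sem)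

/-- The equivalence relation `δ(x, y) ∈ I`, for an ideal `I` of the semilattice of `A`. -/
def idealSetoid : Setoid A.carrier where
  r x y := A.dist x y ∈ I
  iseqv :=
    ⟨fun x => by rw [(A.dist_eq_bot x x).2 rfl]; exact I.bot_mem,
     fun {x y} h => by rw [A.dist_comm y x]; exact h,
     fun {x y z} h₁ h₂ => I.lower (A.dist_triangle x z y) (Order.Ideal.sup_mem h₁ h₂)⟩

/-- The partial algebra `A / I`: an operation is defined at a pair of classes if and only if it is
defined in `A` at some pair of representatives, and then it is computed there. -/
@[reducible] noncomputable def quotAlg : PartialAlg (Quotient (A.idealSetoid I)) where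
  op l a b :=
    ⟨∃ p : A.carrier × A.carrier, (PartialAlg.op l p.1 p.2).Dom ∧
        Quotient.mk (A.idealSetoid I) p.1 = a ∧ Quotient.mk (A.idealSetoid I) p.2 = b,
      fun h => Quotient.mk (A.idealSetoid I)
        ((PartialAlg.op l h.choose.1 h.choose.2).get h.choose_spec.1)⟩

theorem mem_quotAlg_op {l : LatOp} {a b c : Quotient (A.idealSetoid I)} :
    c ∈ (A.quotAlg I).op l a b ↔ ∃ x y z, z ∈ PartialAlg.op l x y ∧
      Quotient.mk (A.idealSetoid I) x = a ∧ Quotient.mk (A.idealSetoid I) y = b ∧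
      Quotient.mk (A.idealSetoid I) z = c := by
  constructor
  · rintro ⟨h, rfl⟩
    exact ⟨_, _, _, Part.get_mem h.choose_spec.1, h.choose_spec.2.1, h.choose_spec.2.2, rfl⟩
  · rintro ⟨x, y, z, hz, rfl, rfl, rfl⟩
    have h : ∃ p : A.carrier × A.carrier, (PartialAlg.op l p.1 p.2).Dom ∧
        Quotient.mk (A.idealSetoid I) p.1 = Quotient.mk (A.idealSetoid I) x ∧
        Quotient.mk (A.idealSetoid I) p.2 = Quotient.mk (A.idealSetoid I) y :=
      ⟨(x, y), hz.1, rfl, rfl⟩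
    refine ⟨h, Quotient.sound ?_⟩
    have h₀ : A.dist h.choose.1 x ∈ I := Quotient.exact h.choose_spec.2.1
    have h₁ : A.dist h.choose.2 y ∈ I := Quotient.exact h.choose_spec.2.2
    exact I.lower (A.dist_op l _ _ _ _ _ _ (Part.get_mem h.choose_spec.1) hz)
      (Order.Ideal.sup_mem h₀ h₁)

/-- A pregamp of the variety `V`: all quotients `A / I` satisfy all identities of `V`. -/
def IsOf (A : Pregamp.{u}) (V : LatticeVariety) : Prop :=
  ∀ s t : LatTerm, LatticeVariety.Identity.{u} V s t →
    ∀ I : Order.Ideal A.sem, (A.quotAlg I).Satisfies s t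

end Pregamp

/-- The pregamp `(L, Θ_L, Con_c L)` of a lattice `L`. -/
@[reducible] def pregampOfLattice (L : Type u) [Lattice L] : Pregamp.{u} where
  carrier := L
  palg := PartialAlg.ofLattice L
  sem := ConC L
  dist := theta
  dist_eq_bot x y := by
    have hb : ∀ a b : L, (⊥ : LatticeCon L).r a b → a = b := fun a b h =>
      (show (⊥ : LatticeCon L) ≤
        { r := Eq, iseqv := eq_equivalence, inf := fun h₁ h₂ => by rw [h₁, h₂],
          sup := fun h₁ h₂ => by rw [h₁, h₂] } from bot_le) h
    constructor
    · intro h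
      have h' : principalCon x y = ⊥ := congrArg Subtype.val h
      exact hb x y (h' ▸ principalCon_rel x y)
    · rintro rfl
      exact Subtype.ext (le_bot_iff.1 (principalCon_le_iff.2 ((⊥ : LatticeCon L).iseqv.refl x)))
  dist_comm x y := Subtype.ext (le_antisymm
    (principalCon_le_iff.2 ((principalCon y x).iseqv.symm (principalCon_rel y x)))
    (principalCon_le_iff.2 ((principalCon x y).iseqv.symm (principalCon_rel x y))))
  dist_triangle x y z := by
    change principalCon x y ≤ principalCon x z ⊔ principalCon z y
    have h₁ : principalCon x z ≤ principalCon x z ⊔ principalCon z y := le_sup_left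
    have h₂ : principalCon z y ≤ principalCon x z ⊔ principalCon z y := le_sup_right
    exact principalCon_le_iff.2 ((principalCon x z ⊔ principalCon z y).iseqv.trans
      (principalCon_le_iff.1 h₁) (principalCon_le_iff.1 h₂))
  dist_op l x₀ x₁ y₀ y₁ x y hx hy := by
    change principalCon x y ≤ principalCon x₀ y₀ ⊔ principalCon x₁ y₁
    have h₁ : principalCon x₀ y₀ ≤ principalCon x₀ y₀ ⊔ principalCon x₁ y₁ := le_sup_left
    have h₂ : principalCon x₁ y₁ ≤ principalCon x₀ y₀ ⊔ principalCon x₁ y₁ := le_sup_right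
    rw [principalCon_le_iff] at h₁ h₂ ⊢
    obtain rfl := Part.mem_some_iff.1 hx
    obtain rfl := Part.mem_some_iff.1 hy
    cases l
    · exact LatticeCon.sup _ h₁ h₂
    · exact LatticeCon.inf _ h₁ h₂

/-- The functor `PGA` from lattices to pregamps: it maps `L` to `(L, Θ_L, Con_c L)` and `f` to
`(f, Con_c f)`. -/
def PGA : Lat.{u} ⥤ Pregamp.{u} where
  obj L := pregampOfLattice L
  map f :=
    { toFun := f.hom
      semHom := mapConC f.hom
      map_op := fun l x y z h => by
        obtain rfl := Part.mem_some_iff.1 h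
        refine Part.mem_some_iff.2 ?_
        cases l
        · exact map_sup f.hom x y
        · exact map_inf f.hom x y
      map_dist := fun x y => Subtype.ext (mapCon_principalCon f.hom x y).symm }
  map_id L := Pregamp.Hom.ext rfl (DFunLike.ext _ _ fun c => Subtype.ext
    (eq_of_forall_ge_iff fun d => (gc_mapCon (LatticeHom.id L)) c.1 d))
  map_comp {L M N} f g := Pregamp.Hom.ext rfl (DFunLike.ext _ _ fun c => Subtype.ext
    (eq_of_forall_ge_iff fun d => ((gc_mapCon (g.hom.comp f.hom)) c.1 d).trans
      (((gc_mapCon f.hom).compose (gc_mapCon g.hom)) c.1 d).symm))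

/-! ### Gamps -/

/-- Gamps: a pregamp `(A, δ, S)` with a partial subalgebra `A^*` of `A`, here `star`. -/
structure Gamp : Type (u + 1) extends Pregamp.{u} where
  star : PartialSubalg carrier

namespace Gamp

/-- A morphism of gamps is a morphism `f` of pregamps such that `f(A^*)` is a partial subalgebra
of `B^*`. -/
@[ext] structure Hom (A B : Gamp.{u}) extends Pregamp.Hom A.toPregamp B.toPregamp where
  map_star : ∀ x ∈ A.star.carrier, toFun x ∈ B.star.carrier
  map_dom : ∀ (l : LatOp) (x y : A.carrier), A.star.dom l x y →
    B.star.dom l (toFun x) (toFun y)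

/-- The category of gamps. -/
instance : Category Gamp.{u} where
  Hom := Hom
  id A := ⟨𝟙 A.toPregamp, fun _ h => h, fun _ _ _ h => h⟩
  comp {A B C} f g :=
    ⟨(show A.toPregamp ⟶ C.toPregamp from
        (show A.toPregamp ⟶ B.toPregamp from f.toHom) ≫
          (show B.toPregamp ⟶ C.toPregamp from g.toHom)),
      fun x h => g.map_star _ (f.map_star x h),
      fun l x y h => g.map_dom l _ _ (f.map_dom l x y h)⟩

/-- The pregamp `(A^*, δ, S)` of a gamp `(A^*, A, δ, S)`. -/
@[reducible] def left (A : Gamp.{u}) : Pregamp.{u} where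
  carrier := {x // x ∈ A.star.carrier}
  palg := A.star.palg
  sem := A.sem
  dist x y := A.dist x.1 y.1
  dist_eq_bot x y := (A.dist_eq_bot x.1 y.1).trans Subtype.ext_iff.symm
  dist_comm x y := A.dist_comm x.1 y.1
  dist_triangle x y z := A.dist_triangle x.1 y.1 z.1
  dist_op l x₀ x₁ y₀ y₁ x y hx hy := A.dist_op l x₀.1 x₁.1 y₀.1 y₁.1 x.1 y.1
    ((A.star.mem_op).1 hx).2 ((A.star.mem_op).1 hy).2

/-- The functor that maps a gamp `(A^*, A, δ, S)` to the pregamp `(A^*, δ, S)`, and restricts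
morphisms accordingly. -/
def PGGL : Gamp.{u} ⥤ Pregamp.{u} where
  obj A := A.left
  map {A B} f :=
    { toFun := fun x => ⟨f.toFun x.1, f.map_star x.1 x.2⟩
      semHom := f.semHom
      map_op := fun l _ _ _ h =>
        (B.star.mem_op).2 ⟨f.map_dom l _ _ ((A.star.mem_op).1 h).1,
          f.map_op l _ _ _ ((A.star.mem_op).1 h).2⟩
      map_dist := fun x y => f.map_dist x.1 y.1 }
  map_id _ := rfl
  map_comp _ _ := rfl

/-- A gamp of lattices, that is, of the variety of all lattices. -/
def IsOfLattices (A : Gamp.{u}) : Prop := A.toPregamp.IsOf LatticeVariety.all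

/-- Lattice congruence `n`-permutability of a gamp (only `x 0, …, x n` and `y 0, …, y n` matter). -/
def LatticeCongruencePermutable (A : Gamp.{u}) (n : ℕ) : Prop :=
  ∀ x : ℕ → A.carrier, (∀ i ≤ n, x i ∈ A.star.carrier) →
    ∃ y : ℕ → A.carrier,
      (∀ i j, i ≤ j → j ≤ n →
        y i ∈ PartialAlg.op .inf (y i) (y j) ∧ y i ∈ PartialAlg.op .inf (y j) (y i)) ∧
      (y 0 ∈ PartialAlg.op .inf (x 0) (x n) ∧ y 0 ∈ PartialAlg.op .inf (x n) (x 0)) ∧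
      (y n ∈ PartialAlg.op .sup (x 0) (x n) ∧ y n ∈ PartialAlg.op .sup (x n) (x 0)) ∧
      (∀ k < n, Odd k → A.dist (y k) (y (k + 1)) ≤
        ((Finset.range n).filter fun i => Even i).sup fun i => A.dist (x i) (x (i + 1))) ∧
      (∀ k < n, Even k → A.dist (y k) (y (k + 1)) ≤
        ((Finset.range n).filter fun i => Odd i).sup fun i => A.dist (x i) (x (i + 1)))

/-- A morphism `f : A ⟶ B` of gamps is operational if all operations are defined in `B` on all
tuples of elements of `f(A) ∪ B^*`. -/
def IsOperational {A B : Gamp.{u}} (f : A ⟶ B) : Prop :=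
  ∀ (l : LatOp) (x y : B.carrier), x ∈ Set.range (Hom.toHom f).toFun ∪ B.star.carrier →
    y ∈ Set.range (Hom.toHom f).toFun ∪ B.star.carrier → (PartialAlg.op l x y).Dom

/-- A diagram of gamps is operational if its morphisms `p → q` are operational for `p < q`. -/
def IsOperationalDiagram {P : Type v} [PartialOrder P] (B : P ⥤ Gamp.{u}) : Prop :=
  ∀ (p q : P) (h : p < q), IsOperational (B.map (homOfLE h.le))

end Gamp

/-! ### Norm-coverings, lifters and condensates -/

/-- A finite subset `V` is a kernel if below every element there is a largest element of `V`. -/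
def IsKernel {X : Type u} [PartialOrder X] (V : Finset X) : Prop :=
  ∀ x : X, ∃ v, IsGreatest {w | w ∈ V ∧ w ≤ x} v

/-- A poset is supported if every finite subset is contained in a kernel. -/
def IsSupported (X : Type u) [PartialOrder X] : Prop :=
  ∀ s : Finset X, ∃ V : Finset X, s ⊆ V ∧ IsKernel V

/-- Norm-coverings of `P`: a supported poset with an isotone map `∂` to `P`. -/
structure NormCovering (P : Type v) [PartialOrder P] where
  carrier : Type u
  [order : PartialOrder carrier]
  supported : IsSupported carrier
  norm : carrier →o P

attribute [instance] NormCovering.order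

namespace NormCovering

variable {P : Type v} [PartialOrder P]

/-- Sharp ideals: those ideals on which the norm has a largest value. Ordered by inclusion. -/
def SharpIdeal (X : NormCovering.{u} P) : Type u :=
  {I : Order.Ideal X.carrier // ∃ p, IsGreatest (X.norm '' (I : Set X.carrier)) p}

instance (X : NormCovering.{u} P) : PartialOrder X.SharpIdeal :=
  inferInstanceAs (PartialOrder {I : Order.Ideal X.carrier //
    ∃ p, IsGreatest (X.norm '' (I : Set X.carrier)) p})

/-- The norm of a sharp ideal. -/
noncomputable def SharpIdeal.norm {X : NormCovering.{u} P} (I : X.SharpIdeal) : P := I.2.choose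

theorem SharpIdeal.isGreatest_norm {X : NormCovering.{u} P} (I : X.SharpIdeal) :
    IsGreatest (X.norm '' (I.1 : Set X.carrier)) I.norm := I.2.choose_spec

/-- `(X, 𝒳)` is an `ℵ₀`-lifter of `P`. (In the second clause only the values of `S` at the members
of `𝒳` with non-maximal norm matter.) -/
structure IsAlephZeroLifter (X : NormCovering.{u} P) (𝒳 : Set X.SharpIdeal) : Prop where
  lower_finite : ∀ x ∈ 𝒳, ¬ IsMax x.norm → {y | y ∈ 𝒳 ∧ y ≤ x}.Finite
  exists_section : ∀ S : X.SharpIdeal → Finset X.carrier, ∃ σ : P →o X.SharpIdeal,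
    (∀ p, σ p ∈ 𝒳) ∧ (∀ p, (σ p).norm = p) ∧
    ∀ p q, p < q → ∀ a ∈ S (σ p), a ∈ (σ q).1 → a ∈ (σ p).1

/-- `t` is supported by the kernel `V`: every `t u` is the image of `t v`, where `v` is the largest
element of `V` below `u`. -/
def IsSupportedBy (X : NormCovering.{u} P) (A : P ⥤ Lat.{w})
    (t : ∀ x : X.carrier, A.obj (X.norm x)) (V : Finset X.carrier) : Prop :=
  ∀ (x v : X.carrier) (h : IsGreatest {w | w ∈ V ∧ w ≤ x} v),
    t x = (A.map (homOfLE (X.norm.monotone h.1.2))).hom (t v)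

theorem IsSupportedBy.mono {X : NormCovering.{u} P} {A : P ⥤ Lat.{w}}
    {t : ∀ x : X.carrier, A.obj (X.norm x)} {V W : Finset X.carrier} (hV : IsKernel V)
    (ht : X.IsSupportedBy A t V) (hVW : V ⊆ W) : X.IsSupportedBy A t W := by
  intro x z hz
  obtain ⟨v, hv⟩ := hV x
  have hvz : v ≤ z := hz.2 ⟨hVW hv.1.1, hv.1.2⟩
  have hv' : IsGreatest {w | w ∈ V ∧ w ≤ z} v :=
    ⟨⟨hv.1.1, hvz⟩, fun w hw => hv.2 ⟨hw.1, hw.2.trans hz.1.2⟩⟩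
  rw [ht x v hv, ht z v hv', ← Lat.comp_apply, ← A.map_comp]
  rfl

/-- The condensate `F(X) ⊗ A` of the diagram `A`: the sublattice of the product of the `A (∂ x)`,
for `x` in `X`, that consists of the elements supported by some kernel. The elements supported by a
given kernel `V` form a copy of the finite product of the `A (∂ v)`, `v ∈ V`, and the condensate
is the directed union of these. -/
def condensate (X : NormCovering.{u} P) (A : P ⥤ Lat.{w}) :
    Sublattice (∀ x : X.carrier, A.obj (X.norm x)) where
  carrier := {t | ∃ V : Finset X.carrier, IsKernel V ∧ X.IsSupportedBy A t V}
  supClosed' := by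
    classical
    rintro s ⟨V, hV, hs⟩ t ⟨V', hV', ht⟩
    obtain ⟨W, hW, hWk⟩ := X.supported (V ∪ V')
    refine ⟨W, hWk, fun x v h => ?_⟩
    rw [Pi.sup_apply, Pi.sup_apply, map_sup,
      hs.mono hV (Finset.union_subset_left hW) x v h,
      ht.mono hV' (Finset.union_subset_right hW) x v h]
  infClosed' := by
    classical
    rintro s ⟨V, hV, hs⟩ t ⟨V', hV', ht⟩
    obtain ⟨W, hW, hWk⟩ := X.supported (V ∪ V')
    refine ⟨W, hWk, fun x v h => ?_⟩
    rw [Pi.inf_apply, Pi.inf_apply, map_inf,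
      hs.mono hV (Finset.union_subset_left hW) x v h,
      ht.mono hV' (Finset.union_subset_right hW) x v h]

end NormCovering

end CondLift

open CondLift

namespace CondLift

/-! ### Monotone chains in congruence `n`-permutable lattices -/

section Permutability

/-! Write `C` for the condensate. For a sharp ideal `x` of norm `p`, an element of `C` has an
eventual value along `x` in `A p`. This gives a surjective homomorphism `proj` from `C` onto `A p`.
Since `B` preserves the congruences of `C`, restriction sends compact congruences of `B` to compact
congruences of `C`. Pushing these forward along `proj` equips `B` with a distance valued in `Con_c
(A p)`. On the images of elements of `C` it is the distance `Θ` between their projections.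

The gamp at `p` consists of the classes, modulo distance zero, of a set `F p` of elements of `B`;
its starred part comes from a set `G p` of representatives in `C` of the elements of `A p`, so it is
a copy of `A p`. A partial operation is defined when its value in `B` has, up to distance zero, a
representative in `F p`. Identities then hold in all quotients because they hold in `B` modulo a
congruence (`isOf_pregamp`). Congruence `n`-permutability holds because `F p` contains monotone
chains of `B` for all sequences in the image of `G p` (`exists_monotone_chain`). Operationality
holds because `F q` absorbs the operations on `F p` and on the image of `G q`, for `p < q`
(`exists_absorbing_family`).

The difficulty is that the projections at `p` and `q` need not commute with `A p → A q`. They do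
commute on elements supported by a kernel whose members in the larger ideal all lie in the smaller
one (`map_proj_of_isSupportedBy`). At non-maximal norm, all the relevant data are finite: `A p` is
finite, `F p` can be chosen finite, and the distances between its elements, and from operation
values to them, depend on finitely many generators in `C`. So one kernel supports everything, and
the lifter supplies a section `σ` along which these kernels behave as required. At maximal norm
nothing has to be transported upwards, and `F p` may be all of `B`. -/

theorem reflTransGen_of_chain {X : Type u} {r : X → X → Prop} {n : ℕ} {x : ℕ → X}
    (hx : ∀ i < n, r (x i) (x (i + 1))) : Relation.ReflTransGen r (x 0) (x n) := by
  induction n with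
  | zero => exact .refl
  | succ n ih => exact (ih fun i hi => hx i (hi.trans n.lt_succ_self)).tail (hx n n.lt_succ_self)

variable {L : Type u} [Lattice L]

theorem altComp_of_left {n : ℕ} (hn : 0 < n) {α β : LatticeCon L} {x y z : L} (hxy : α.r x y)
    (hyz : altComp n α β y z) : altComp n α β x z := by
  cases n with
  | zero => exact absurd hn (lt_irrefl 0)
  | succ n =>
    obtain ⟨t, hyt, htz⟩ := hyz
    exact ⟨t, α.iseqv.trans hxy hyt, htz⟩

theorem altComp_refl (n : ℕ) (α β : LatticeCon L) (x : L) : altComp n α β x x := by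
  induction n generalizing α β with
  | zero => exact rfl
  | succ n ih => exact ⟨x, α.iseqv.refl x, ih β α⟩

/-- A step of a path is absorbed by the first factor when both belong to the same congruence.
Otherwise `n`-permutability first exchanges the two alternating products, so paths of any length
shrink to `n` factors. -/
theorem altComp_of_reflTransGen {n : ℕ} (hn : 0 < n) (hL : CongruencePermutable L n)
    {α β : LatticeCon L} {x y : L}
    (h : Relation.ReflTransGen (fun a b => α.r a b ∨ β.r a b) x y) : altComp n α β x y := by
  induction h using Relation.ReflTransGen.head_induction_on with
  | refl => exact altComp_refl n α β y
  | head hab _ ih =>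
    rcases hab with hab | hab
    · exact altComp_of_left hn hab ih
    · rw [hL α β] at ih ⊢
      exact altComp_of_left hn hab ih

theorem exists_chain_of_altComp {n : ℕ} {α β : LatticeCon L} {x y : L}
    (h : altComp n α β x y) : ∃ z : ℕ → L, z 0 = x ∧ z n = y ∧
      ∀ k < n, (Even k → α.r (z k) (z (k + 1))) ∧ (Odd k → β.r (z k) (z (k + 1))) := by
  induction n generalizing α β x with
  | zero => exact ⟨fun _ => x, rfl, h, fun k hk => absurd hk (Nat.not_lt_zero k)⟩
  | succ n ih =>
    obtain ⟨t, hxt, hty⟩ := h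
    obtain ⟨z, hz₀, hzn, hz⟩ := ih hty
    refine ⟨fun k => Nat.casesOn k x z, rfl, hzn, fun k hk => ?_⟩
    cases k with
    | zero => exact ⟨fun _ => by simpa [hz₀] using hxt, fun h => absurd h (by decide)⟩
    | succ k =>
      have := hz k (Nat.lt_of_succ_lt_succ hk)
      exact ⟨fun h => this.2 (by grind), fun h => this.1 (by grind)⟩

/-- Meeting the reversed path with `x 0` and joining the path with `x 0` connects `x 0 ⊓ x n` to `x
0` and then to `x 0 ⊔ x n`. Permutability shortens this to `n` alternating steps, which lattice
polynomials then make monotone. -/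
theorem exists_monotone_chain {n : ℕ} (hn : 0 < n) (hL : CongruencePermutable L n)
    (α β : LatticeCon L) (x : ℕ → L)
    (hx : ∀ i < n, α.r (x i) (x (i + 1)) ∨ β.r (x i) (x (i + 1))) :
    ∃ y : ℕ → L, Monotone y ∧ y 0 = x 0 ⊓ x n ∧ y n = x 0 ⊔ x n ∧
      ∀ k < n, (Even k → β.r (y k) (y (k + 1))) ∧ (Odd k → α.r (y k) (y (k + 1))) := by
  have h₁ := reflTransGen_of_chain (r := fun a b => α.r a b ∨ β.r a b) hx
  have hlift : ∀ (f : L → L) (_ : ∀ (c : LatticeCon L) a b, c.r a b → c.r (f a) (f b)) {a b : L},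
      Relation.ReflTransGen (fun a b => α.r a b ∨ β.r a b) a b →
        Relation.ReflTransGen (fun a b => α.r a b ∨ β.r a b) (f a) (f b) := by
    intro f hf a b hab
    induction hab with
    | refl => exact .refl
    | tail _ h ih => exact ih.tail (h.imp (hf α _ _) (hf β _ _))
  have hinf : Relation.ReflTransGen (fun a b => α.r a b ∨ β.r a b) (x 0 ⊓ x n) (x 0) := by
    have h₂ : Relation.ReflTransGen (fun a b => α.r a b ∨ β.r a b) (x n) (x 0) :=
      Relation.ReflTransGen.mono
        (fun _ _ h => h.imp (fun h => α.iseqv.symm h) fun h => β.iseqv.symm h) _ _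
        (Relation.reflTransGen_swap.2 h₁)
    simpa using hlift (fun t => x 0 ⊓ t) (fun c _ _ h => c.inf (c.iseqv.refl _) h) h₂
  have hsup : Relation.ReflTransGen (fun a b => α.r a b ∨ β.r a b) (x 0) (x 0 ⊔ x n) := by
    simpa using hlift (fun t => x 0 ⊔ t) (fun c _ _ h => c.sup (c.iseqv.refl _) h) h₁
  have h := altComp_of_reflTransGen hn hL (hinf.trans hsup)
  -- The exchange puts `β` on the even steps, the parity required of the chain.
  rw [hL α β] at h
  obtain ⟨z, hz₀, hzn, hz⟩ := exists_chain_of_altComp h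
  -- Truncation to the interval `[x 0 ⊓ x n, x 0 ⊔ x n]` preserves congruent steps, and so does
  -- taking partial joins. The latter gives monotonicity without moving the endpoints.
  let t : ℕ → L := fun k => (z k ⊔ x 0 ⊓ x n) ⊓ (x 0 ⊔ x n)
  have ht : ∀ (c : LatticeCon L) k, c.r (z k) (z (k + 1)) →
      c.r (partialSups t k) (partialSups t (k + 1)) := by
    intro c k hk
    have htk : c.r (t k) (t (k + 1)) :=
      c.inf (c.sup hk (c.iseqv.refl _)) (c.iseqv.refl _)
    have := c.sup (c.iseqv.refl (partialSups t k)) htk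
    rwa [← partialSups_add_one, sup_eq_left.2 (le_partialSups t k)] at this
  refine ⟨partialSups t, (partialSups t).monotone, ?_, ?_, fun k hk =>
    ⟨fun h => ht β k ((hz k hk).1 h), fun h => ht α k ((hz k hk).2 h)⟩⟩
  · simp [t, hz₀, (inf_le_left : x 0 ⊓ x n ≤ x 0).trans le_sup_left]
  · apply le_antisymm
    · exact partialSups_le _ _ _ fun _ _ => inf_le_right
    · refine le_trans ?_ (le_partialSups t n)
      simp [t, hzn]

end Permutability

/-! ### Distances on lattices -/

/-- A distance on a lattice, valued in a join-semilattice with zero, that is compatible with the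
operations; different elements may have distance zero. -/
structure LatticeDist (L : Type u) [Lattice L] (S : Type w) [SemilatticeSup S] [OrderBot S] where
  dist : L → L → S
  self : ∀ x, dist x x = ⊥
  comm : ∀ x y, dist x y = dist y x
  triangle : ∀ x y z, dist x y ≤ dist x z ⊔ dist z y
  op : ∀ (l : LatOp) (x₀ x₁ y₀ y₁ : L),
    dist (l.eval x₀ x₁) (l.eval y₀ y₁) ≤ dist x₀ y₀ ⊔ dist x₁ y₁

namespace LatticeDist

variable {L : Type u} [Lattice L] {S T : Type w} [SemilatticeSup S] [OrderBot S]
  [SemilatticeSup T] [OrderBot T]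

variable (L) in
/-- The distance `Θ`. -/
def theta : LatticeDist L (ConC L) where
  dist := CondLift.theta
  self x := ((pregampOfLattice L).dist_eq_bot x x).2 rfl
  comm := (pregampOfLattice L).dist_comm
  triangle := (pregampOfLattice L).dist_triangle
  op l x₀ x₁ y₀ y₁ := (pregampOfLattice L).dist_op l x₀ x₁ y₀ y₁ _ _
    (Part.mem_some _) (Part.mem_some _)

/-- The image of a distance under a semilattice homomorphism. -/
def map (D : LatticeDist L S) (f : SupBotHom S T) : LatticeDist L T where
  dist x y := f (D.dist x y)
  self x := by rw [D.self, map_bot]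
  comm x y := by rw [D.comm]
  triangle x y z := by
    rw [← map_sup]
    exact OrderHomClass.mono f (D.triangle x y z)
  op l x₀ x₁ y₀ y₁ := by
    rw [← map_sup]
    exact OrderHomClass.mono f (D.op l x₀ x₁ y₀ y₁)

variable (D : LatticeDist L S)

/-- The congruence of all pairs whose distance belongs to a given ideal. -/
def con (I : Order.Ideal S) : LatticeCon L where
  r x y := D.dist x y ∈ I
  iseqv := ⟨fun x => by rw [D.self]; exact I.bot_mem, fun {x y} h => by rwa [D.comm],
    fun {x y z} h₁ h₂ => I.lower (D.triangle x z y) (Order.Ideal.sup_mem h₁ h₂)⟩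
  inf h₁ h₂ := I.lower (D.op .inf _ _ _ _) (Order.Ideal.sup_mem h₁ h₂)
  sup h₁ h₂ := I.lower (D.op .sup _ _ _ _) (Order.Ideal.sup_mem h₁ h₂)

/-- The pairs whose distance lies in the principal ideal of the right-hand side form a congruence
containing all the generators. -/
theorem dist_le_of_rel {ι : Type*} {s : Finset ι} {a b : ι → L} {x y : L}
    (h : (s.sup fun i => principalCon (a i) (b i)).r x y) :
    D.dist x y ≤ s.sup fun i => D.dist (a i) (b i) := by
  have hle : (s.sup fun i => principalCon (a i) (b i)) ≤
      D.con (Order.Ideal.principal (s.sup fun i => D.dist (a i) (b i))) :=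
    Finset.sup_le fun i hi => principalCon_le_iff.2 <| Order.Ideal.mem_principal.2 <|
      Finset.le_sup (f := fun i => D.dist (a i) (b i)) hi
  exact Order.Ideal.mem_principal.1 (hle h)

theorem dist_congr {x x' y y' : L} (hx : D.dist x x' = ⊥) (hy : D.dist y y' = ⊥) :
    D.dist x y = D.dist x' y' := by
  have key : ∀ {x x' y y' : L}, D.dist x x' = ⊥ → D.dist y y' = ⊥ →
      D.dist x y ≤ D.dist x' y' := fun {x x' y y'} hx hy =>
    calc D.dist x y ≤ D.dist x x' ⊔ (D.dist x' y' ⊔ D.dist y' y) :=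
          (D.triangle x y x').trans (sup_le_sup_left (D.triangle x' y y') _)
      _ = D.dist x' y' := by rw [hx, D.comm y' y, hy, bot_sup_eq, sup_bot_eq]
  exact le_antisymm (key hx hy) (key (D.comm x x' ▸ hx) (D.comm y y' ▸ hy))

theorem dist_op_eq_bot {x x' y y' : L} (l : LatOp) (hx : D.dist x x' = ⊥)
    (hy : D.dist y y' = ⊥) : D.dist (l.eval x y) (l.eval x' y') = ⊥ :=
  le_bot_iff.1 ((D.op l x y x' y').trans (by rw [hx, hy, bot_sup_eq]))

/-! ### The gamp of a subset of a lattice with a distance -/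

variable (F : Set L)

/-- Distance zero, as an equivalence relation on a set. -/
def setoid : Setoid F where
  r x y := D.dist x y = ⊥
  iseqv := ⟨fun x => D.self x, fun {x y} h => by rwa [D.comm],
    fun {x y z} h₁ h₂ => by rw [D.dist_congr h₁ (D.self z), h₂]⟩

/-- The class of an element modulo distance zero. -/
def cls (x : L) (hx : x ∈ F) : Quotient (D.setoid F) := Quotient.mk _ ⟨x, hx⟩

variable {F}

theorem cls_eq_cls {x y : L} {hx : x ∈ F} {hy : y ∈ F} :
    D.cls F x hx = D.cls F y hy ↔ D.dist x y = ⊥ := Quotient.eq (r := D.setoid F)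

theorem exists_cls (a : Quotient (D.setoid F)) : ∃ x hx, D.cls F x hx = a := by
  obtain ⟨⟨x, hx⟩, rfl⟩ := Quotient.exists_rep a
  exact ⟨x, hx, rfl⟩

variable (F)

/-- The partial operations on the quotient of a set by distance zero: the value is defined if it
belongs to that quotient. -/
@[reducible] noncomputable def palg : PartialAlg (Quotient (D.setoid F)) where
  op l a b := ⟨∃ z x y : F, D.cls F x x.2 = a ∧ D.cls F y y.2 = b ∧
      D.dist (l.eval x.1 y.1) z = ⊥, fun h => D.cls F h.choose h.choose.2⟩

variable {F}

/-- The chosen value does not matter: compatibility with the operations puts any two candidates at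
distance zero, whatever the representatives. -/
theorem cls_mem_op {l : LatOp} {x y z : L} {hx : x ∈ F} {hy : y ∈ F} {hz : z ∈ F} :
    D.cls F z hz ∈ (D.palg F).op l (D.cls F x hx) (D.cls F y hy) ↔
      D.dist (l.eval x y) z = ⊥ := by
  have key : ∀ h : ((D.palg F).op l (D.cls F x hx) (D.cls F y hy)).Dom,
      D.dist (l.eval x y) h.choose = ⊥ := by
    intro h
    obtain ⟨x', y', hx', hy', h'⟩ := h.choose_spec
    rw [D.dist_congr (D.dist_op_eq_bot l (D.cls_eq_cls.1 hx'.symm) (D.cls_eq_cls.1 hy'.symm))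
      (D.self _), h']
  constructor
  · rintro ⟨h, h'⟩
    rw [D.dist_congr (D.self _) (D.cls_eq_cls.1 h'.symm), key h]
  · intro h
    have hd : ((D.palg F).op l (D.cls F x hx) (D.cls F y hy)).Dom :=
      ⟨⟨z, hz⟩, ⟨x, hx⟩, ⟨y, hy⟩, rfl, rfl, h⟩
    refine ⟨hd, D.cls_eq_cls.2 ?_⟩
    rw [D.dist_congr (D.comm _ _ ▸ key hd) (D.comm _ _ ▸ h), D.self]

theorem exists_of_mem_op {l : LatOp} {a b c : Quotient (D.setoid F)}
    (h : c ∈ (D.palg F).op l a b) : ∃ x y z, ∃ hx hy hz, D.cls F x hx = a ∧ D.cls F y hy = b ∧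
      D.cls F z hz = c ∧ D.dist (l.eval x y) z = ⊥ := by
  obtain ⟨x, hx, rfl⟩ := D.exists_cls a
  obtain ⟨y, hy, rfl⟩ := D.exists_cls b
  obtain ⟨z, hz, rfl⟩ := D.exists_cls c
  exact ⟨x, y, z, hx, hy, hz, rfl, rfl, rfl, D.cls_mem_op.1 h⟩

end LatticeDist
namespace LatticeDist

variable {L : Type u} [Lattice L] {S : Type u} [SemilatticeSup S] [OrderBot S]
  (D : LatticeDist L S)

/-- The pregamp of all classes, modulo distance zero, of elements of a set. -/
@[reducible] noncomputable def pregamp (F : Set L) : Pregamp.{u} where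
  carrier := Quotient (D.setoid F)
  palg := D.palg F
  sem := S
  dist := Quotient.lift₂ (fun x y : F => D.dist x y) fun _ _ _ _ hx hy => D.dist_congr hx hy
  dist_eq_bot := by
    rintro ⟨x⟩ ⟨y⟩
    exact D.cls_eq_cls.symm
  dist_comm := by
    rintro ⟨x⟩ ⟨y⟩
    exact D.comm x y
  dist_triangle := by
    rintro ⟨x⟩ ⟨y⟩ ⟨z⟩
    exact D.triangle x y z
  dist_op := by
    rintro l ⟨x₀⟩ ⟨x₁⟩ ⟨y₀⟩ ⟨y₁⟩ ⟨x⟩ ⟨y⟩ hx hy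
    have hx := D.cls_mem_op.1 hx
    have hy := D.cls_mem_op.1 hy
    change D.dist x y ≤ D.dist x₀ y₀ ⊔ D.dist x₁ y₁
    rw [← D.dist_congr hx hy]
    exact D.op l x₀ x₁ y₀ y₁

/-- By induction on terms, a defined value in the quotient by `I` is represented by an element
congruent, modulo `D.con I`, to the value of the term in the total lattice `L`. Both sides of an
identity have the same value there. -/
theorem isOf_pregamp (F : Set L) : (D.pregamp F).IsOf LatticeVariety.all := by
  intro s t hst I x a ha b hb
  have hrep : ∀ c : Quotient ((D.pregamp F).idealSetoid I), ∃ (z : L) (hz : z ∈ F),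
      Quotient.mk ((D.pregamp F).idealSetoid I) (D.cls F z hz) = c := by
    intro c
    obtain ⟨c, rfl⟩ := Quotient.exists_rep c
    obtain ⟨z, hz, rfl⟩ := D.exists_cls c
    exact ⟨z, hz, rfl⟩
  choose r hr hrx using fun i => hrep (x i)
  have hrel : ∀ {y z : L} {hy : y ∈ F} {hz : z ∈ F},
      Quotient.mk ((D.pregamp F).idealSetoid I) (D.cls F y hy) =
        Quotient.mk ((D.pregamp F).idealSetoid I) (D.cls F z hz) ↔ (D.con I).r y z :=
    Quotient.eq (r := (D.pregamp F).idealSetoid I)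
  have key : ∀ (t : LatTerm) (a : Quotient ((D.pregamp F).idealSetoid I)),
      a ∈ @LatTerm.peval _ ((D.pregamp F).quotAlg I) x t → ∃ (z : L) (hz : z ∈ F),
        Quotient.mk ((D.pregamp F).idealSetoid I) (D.cls F z hz) = a ∧
          (D.con I).r (t.eval r) z := by
    intro t
    induction t with
    | var i =>
      intro a ha
      obtain rfl := Part.mem_some_iff.1 ha
      exact ⟨r i, hr i, hrx i, (D.con I).iseqv.refl _⟩
    | app l s t ihs iht =>
      intro a ha
      obtain ⟨b, hb, ha⟩ := Part.mem_bind_iff.1 ha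
      obtain ⟨c, hc, ha⟩ := Part.mem_bind_iff.1 ha
      obtain ⟨y, hy, rfl, hsy⟩ := ihs b hb
      obtain ⟨z, hz, rfl, htz⟩ := iht c hc
      obtain ⟨y', z', w, hw, hy', hz', rfl⟩ := ((D.pregamp F).mem_quotAlg_op I).1 ha
      obtain ⟨y', z', w, hyF, hzF, hwF, rfl, rfl, rfl, h⟩ := D.exists_of_mem_op hw
      refine ⟨w, hwF, rfl, (D.con I).iseqv.trans (y := l.eval y' z') ?_ ?_⟩
      · have h₁ := (D.con I).iseqv.trans hsy ((D.con I).iseqv.symm (hrel.1 hy'))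
        have h₂ := (D.con I).iseqv.trans htz ((D.con I).iseqv.symm (hrel.1 hz'))
        cases l
        · exact (D.con I).sup h₁ h₂
        · exact (D.con I).inf h₁ h₂
      · change D.dist _ _ ∈ I
        rw [h]
        exact I.bot_mem
  obtain ⟨y, hy, rfl, hsy⟩ := key s a ha
  obtain ⟨z, hz, rfl, htz⟩ := key t b hb
  have hL : s.eval r = t.eval r := hst L (fun e he => absurd he (Set.notMem_empty e)) r
  rw [hL] at hsy
  exact hrel.2 ((D.con I).iseqv.trans ((D.con I).iseqv.symm hsy) htz)

/-- A set is closed under the operations up to distance zero. -/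
def OpClosed (K : Set L) : Prop :=
  ∀ (l : LatOp), ∀ x ∈ K, ∀ y ∈ K, ∃ z ∈ K, D.dist (l.eval x y) z = ⊥

variable {D} {F K : Set L}

theorem OpClosed.exists_mem_op (hK : D.OpClosed K) (hKF : K ⊆ F) (l : LatOp)
    {a b : Quotient (D.setoid F)} (ha : ∃ x, ∃ hx : x ∈ K, D.cls F x (hKF hx) = a)
    (hb : ∃ y, ∃ hy : y ∈ K, D.cls F y (hKF hy) = b) :
    ∃ c ∈ (D.palg F).op l a b, ∃ z, ∃ hz : z ∈ K, D.cls F z (hKF hz) = c := by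
  obtain ⟨x, hx, rfl⟩ := ha
  obtain ⟨y, hy, rfl⟩ := hb
  obtain ⟨z, hz, h⟩ := hK l x hx y hy
  exact ⟨D.cls F z (hKF hz), D.cls_mem_op.2 h, z, hz, rfl⟩

/-- The partial algebra of all classes of elements of `K`, with all operations defined. -/
@[reducible] noncomputable def clsSubalg (hK : D.OpClosed K) (hKF : K ⊆ F) :
    @PartialSubalg _ (D.palg F) :=
  letI := D.palg F
  { carrier := {a | ∃ x, ∃ hx : x ∈ K, D.cls F x (hKF hx) = a}
    dom := fun _ a b => (∃ x, ∃ hx : x ∈ K, D.cls F x (hKF hx) = a) ∧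
      ∃ x, ∃ hx : x ∈ K, D.cls F x (hKF hx) = b
    left_mem := fun h => h.1
    right_mem := fun h => h.2
    dom_sub := fun {l _ _} h => (hK.exists_mem_op hKF l h.1 h.2).choose_spec.1.1
    get_mem := fun {l _ _} h => by
      obtain ⟨c, hc, hz⟩ := hK.exists_mem_op hKF l h.1 h.2
      rwa [Part.get_eq_of_mem hc] }

/-- The gamp of all classes of elements of `F`; its starred part consists of all classes of elements
of `K`, with all operations defined. -/
@[reducible] noncomputable def gamp (hK : D.OpClosed K) (hKF : K ⊆ F) : Gamp.{u} where
  toPregamp := D.pregamp F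
  star := clsSubalg hK hKF

theorem isOfLattices_gamp (hK : D.OpClosed K) (hKF : K ⊆ F) :
    (gamp hK hKF).IsOfLattices := D.isOf_pregamp F

/-- Every sequence in `K` of length `n + 1` has a monotone chain in `F` as in the definition of
congruence `n`-permutability of gamps. -/
def HasMonotoneChains (n : ℕ) (K F : Set L) : Prop :=
  ∀ x : ℕ → L, (∀ i ≤ n, x i ∈ K) → ∃ y : ℕ → L, (∀ k ≤ n, y k ∈ F) ∧ Monotone y ∧
    y 0 = x 0 ⊓ x n ∧ y n = x 0 ⊔ x n ∧
    (∀ k < n, Odd k → (((Finset.range n).filter fun i => Even i).sup fun i =>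
      principalCon (x i) (x (i + 1))).r (y k) (y (k + 1))) ∧
    (∀ k < n, Even k → (((Finset.range n).filter fun i => Odd i).sup fun i =>
      principalCon (x i) (x (i + 1))).r (y k) (y (k + 1)))

theorem latticeCongruencePermutable_gamp {n : ℕ} (hK : D.OpClosed K) (hKF : K ⊆ F)
    (hn : HasMonotoneChains n K F) : (gamp hK hKF).LatticeCongruencePermutable n := by
  intro x hx
  have hx' : ∀ i, ∃ r, i ≤ n → ∃ hr : r ∈ K, D.cls F r (hKF hr) = x i := by
    intro i
    by_cases hi : i ≤ n
    · obtain ⟨r, hr⟩ := hx i hi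
      exact ⟨r, fun _ => hr⟩
    · exact ⟨(hx 0 (Nat.zero_le n)).choose, fun h => absurd h hi⟩
  choose r hr using hx'
  obtain ⟨y, hyF, hmono, hy₀, hyn, hodd, heven⟩ := hn r fun i hi => (hr i hi).1
  -- Only `y 0, …, y n` are known to lie in `F`, so the sequence is made constant from `n` on.
  have hF : ∀ k, y (min k n) ∈ F := fun k => hyF _ (min_le_right k n)
  have hcls : ∀ k ≤ n, ∃ h : y k ∈ F, D.cls F (y (min k n)) (hF k) = D.cls F (y k) h := by
    intro k hk
    refine ⟨hyF k hk, ?_⟩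
    simp only [min_eq_left hk]
  have hop : ∀ {l : LatOp} {a b c : L} {ha hb hc}, l.eval a b = c →
      D.cls F c hc ∈ (D.palg F).op l (D.cls F a ha) (D.cls F b hb) := by
    rintro l a b c ha hb hc rfl
    exact D.cls_mem_op.2 (D.self _)
  have hdist : ∀ (p : ℕ → Prop) [DecidablePred p], ∀ k < n,
      (((Finset.range n).filter fun i => p i).sup fun i =>
        principalCon (r i) (r (i + 1))).r (y k) (y (k + 1)) →
      (D.pregamp F).dist (D.cls F (y (min k n)) (hF k))
        (D.cls F (y (min (k + 1) n)) (hF (k + 1))) ≤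
      ((Finset.range n).filter fun i => p i).sup fun i =>
        (D.pregamp F).dist (x i) (x (i + 1)) := by
    intro p _ k hk h
    obtain ⟨_, h₁⟩ := hcls k hk.le
    obtain ⟨_, h₂⟩ := hcls (k + 1) hk
    rw [h₁, h₂]
    refine (D.dist_le_of_rel h).trans (Finset.sup_mono_fun fun i hi => ?_)
    have hi : i < n := Finset.mem_range.1 (Finset.mem_filter.1 hi).1
    obtain ⟨_, h₁⟩ := hr i hi.le
    obtain ⟨_, h₂⟩ := hr (i + 1) hi
    rw [← h₁, ← h₂]
    exact le_rfl
  obtain ⟨_, hx₀⟩ := hr 0 (Nat.zero_le n)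
  obtain ⟨_, hxn⟩ := hr n le_rfl
  refine ⟨fun k => D.cls F (y (min k n)) (hF k), ?_, ?_, ?_,
    fun k hk ho => hdist _ k hk (hodd k hk ho),
    fun k hk he => hdist _ k hk (heven k hk he)⟩
  · intro i j hij _
    have h := hmono (min_le_min_right n hij)
    exact ⟨hop (inf_eq_left.2 h), hop (inf_eq_right.2 h)⟩
  · obtain ⟨_, h⟩ := hcls 0 (Nat.zero_le n)
    change D.cls F (y (min 0 n)) (hF 0) ∈ _ ∧ D.cls F (y (min 0 n)) (hF 0) ∈ _
    rw [h, ← hx₀, ← hxn]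
    exact ⟨hop hy₀.symm, hop ((inf_comm _ _).trans hy₀.symm)⟩
  · obtain ⟨_, h⟩ := hcls n le_rfl
    change D.cls F (y (min n n)) (hF n) ∈ _ ∧ D.cls F (y (min n n)) (hF n) ∈ _
    rw [h, ← hx₀, ← hxn]
    exact ⟨hop hyn.symm, hop ((sup_comm _ _).trans hyn.symm)⟩

/-! ### Morphisms between gamps of subsets of a lattice -/

section Hom

variable {T : Type u} [SemilatticeSup T] [OrderBot T] {E : LatticeDist L T} {G J : Set L}

/-- A homomorphism carries a distance to another one on a set and on the values of the operations
at this set. -/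
structure Carries (D : LatticeDist L S) (E : LatticeDist L T) (f : SupBotHom S T) (F : Set L) :
    Prop where
  dist : ∀ x ∈ F, ∀ y ∈ F, E.dist x y = f (D.dist x y)
  dist_op : ∀ (l : LatOp), ∀ x ∈ F, ∀ y ∈ F, ∀ z ∈ F,
    E.dist (l.eval x y) z = f (D.dist (l.eval x y) z)

/-- The map of classes induced by an inclusion. -/
def clsMap {f : SupBotHom S T} (hf : Carries D E f F) (hFG : F ⊆ G) :
    Quotient (D.setoid F) → Quotient (E.setoid G) :=
  Quotient.map (Set.inclusion hFG) fun x y h => by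
    change E.dist x.1 y.1 = ⊥
    rw [hf.dist x x.2 y y.2, show D.dist x y = ⊥ from h, map_bot]

/-- The morphism of gamps induced by an inclusion. -/
noncomputable def gampMap {f : SupBotHom S T} (hf : Carries D E f F) (hFG : F ⊆ G)
    (hK : D.OpClosed K) (hKF : K ⊆ F) (hJ : E.OpClosed J) (hJG : J ⊆ G)
    (hKJ : ∀ x ∈ K, ∃ y ∈ J, E.dist y x = ⊥) : gamp hK hKF ⟶ gamp hJ hJG :=
  have hstar : ∀ a : Quotient (D.setoid F), (∃ x, ∃ hx : x ∈ K, D.cls F x (hKF hx) = a) →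
      ∃ x, ∃ hx : x ∈ J, E.cls G x (hJG hx) = clsMap hf hFG a := by
    rintro _ ⟨x, hx, rfl⟩
    obtain ⟨y, hy, h⟩ := hKJ x hx
    exact ⟨y, hy, E.cls_eq_cls.2 h⟩
  { toFun := clsMap hf hFG
    semHom := f
    map_op := fun l a b c h => by
      obtain ⟨x, y, z, hx, hy, hz, rfl, rfl, rfl, hd⟩ := D.exists_of_mem_op h
      exact E.cls_mem_op.2 (by rw [hf.dist_op l x hx y hy z hz, hd, map_bot])
    map_dist := by
      rintro ⟨x⟩ ⟨y⟩
      exact hf.dist x x.2 y y.2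
    map_star := hstar
    map_dom := fun _ _ _ h => ⟨hstar _ h.1, hstar _ h.2⟩ }

theorem isOperational_gampMap {f : SupBotHom S T} (hf : Carries D E f F) (hFG : F ⊆ G)
    (hK : D.OpClosed K) (hKF : K ⊆ F) (hJ : E.OpClosed J) (hJG : J ⊆ G)
    (hKJ : ∀ x ∈ K, ∃ y ∈ J, E.dist y x = ⊥)
    (hop : ∀ (l : LatOp), ∀ x ∈ F ∪ J, ∀ y ∈ F ∪ J, l.eval x y ∈ G) :
    Gamp.IsOperational (gampMap hf hFG hK hKF hJ hJG hKJ) := by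
  have hFJ : F ∪ J ⊆ G := Set.union_subset hFG hJG
  have hrep : ∀ a : Quotient (E.setoid G), (a ∈ Set.range (clsMap hf hFG) ∪
      {a | ∃ x, ∃ hx : x ∈ J, E.cls G x (hJG hx) = a}) →
      ∃ x, ∃ hx : x ∈ F ∪ J, E.cls G x (hFJ hx) = a := by
    rintro _ (⟨a, rfl⟩ | ⟨x, hx, rfl⟩)
    · obtain ⟨x, hx, rfl⟩ := D.exists_cls a
      exact ⟨x, Or.inl hx, rfl⟩
    · exact ⟨x, Or.inr hx, rfl⟩
  intro l a b ha hb
  obtain ⟨x, hx, rfl⟩ := hrep a ha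
  obtain ⟨y, hy, rfl⟩ := hrep b hb
  exact (E.cls_mem_op (hz := hop l x hx y hy).2 (E.self _)).1

end Hom

end LatticeDist
/-! ### Congruence-preserving extensions -/

namespace IsCongruencePreservingExtension

variable {L : Type u} {M : Type w} [Lattice L] [Lattice M] {i : LatticeHom L M}

/-- If the restrictions are ordered, `d ⊓ e` and `d` have the same restriction, hence coincide by
uniqueness. Restriction is therefore an order embedding. -/
theorem comapCon_le_iff (hi : IsCongruencePreservingExtension i) {d e : LatticeCon M} :
    comapCon i d ≤ comapCon i e ↔ d ≤ e := by
  refine ⟨fun h => ?_, fun h => (gc_mapCon i).monotone_u h⟩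
  have hinf : comapCon i (d ⊓ e) = comapCon i d := by
    rw [(gc_mapCon i).u_inf, inf_eq_left.2 h]
  exact inf_eq_left.1 ((hi.2 (comapCon i d)).unique hinf rfl)

theorem comapCon_mapCon (hi : IsCongruencePreservingExtension i) (c : LatticeCon L) :
    comapCon i (mapCon i c) = c := by
  obtain ⟨d, rfl, -⟩ := hi.2 c
  exact (gc_mapCon i).u_l_u_eq_u d

theorem mapCon_comapCon (hi : IsCongruencePreservingExtension i) (d : LatticeCon M) :
    mapCon i (comapCon i d) = d :=
  (hi.2 (comapCon i d)).unique ((gc_mapCon i).u_l_u_eq_u d) rfl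

theorem comapCon_sup (hi : IsCongruencePreservingExtension i) (d e : LatticeCon M) :
    comapCon i (d ⊔ e) = comapCon i d ⊔ comapCon i e := by
  rw [← hi.comapCon_mapCon (comapCon i d ⊔ comapCon i e), (gc_mapCon i).l_sup,
    hi.mapCon_comapCon, hi.mapCon_comapCon]

theorem comapCon_bot (hi : IsCongruencePreservingExtension i) :
    comapCon i (⊥ : LatticeCon M) = ⊥ := by
  rw [← hi.comapCon_mapCon ⊥, (gc_mapCon i).l_bot]

theorem comapCon_principalCon (hi : IsCongruencePreservingExtension i) (x y : L) :
    comapCon i (principalCon (i x) (i y)) = principalCon x y := by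
  rw [← mapCon_principalCon, hi.comapCon_mapCon]

/-- This is the transfer of compactness across the isomorphism of congruence lattices, done by hand
with a directed union. -/
theorem isFGCon_comapCon_principalCon (hi : IsCongruencePreservingExtension i) (x y : M) :
    IsFGCon (comapCon i (principalCon x y)) := by
  have hm : ∀ {c d : LatticeCon L}, c ≤ d → mapCon i c ≤ mapCon i d :=
    fun h => (gc_mapCon i).monotone_l h
  have hdir : ∀ {a b a' b' : M}, (∃ c, IsFGCon c ∧ c ≤ comapCon i (principalCon x y) ∧
      (mapCon i c).r a b) → (∃ c, IsFGCon c ∧ c ≤ comapCon i (principalCon x y) ∧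
      (mapCon i c).r a' b') → ∃ c, IsFGCon c ∧ c ≤ comapCon i (principalCon x y) ∧
      (mapCon i c).r a b ∧ (mapCon i c).r a' b' := by
    rintro a b a' b' ⟨c, hc, hcx, h⟩ ⟨d, hd, hdx, h'⟩
    exact ⟨c ⊔ d, hc.sup hd, sup_le hcx hdx, hm le_sup_left h, hm le_sup_right h'⟩
  -- The directed union of the extensions of the finitely generated congruences below the
  -- restriction of `principalCon x y`. It contains `(x, y)`, so a single one of them already does.
  let e : LatticeCon M :=
    { r := fun a b => ∃ c, IsFGCon c ∧ c ≤ comapCon i (principalCon x y) ∧ (mapCon i c).r a b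
      iseqv := ⟨fun a => ⟨⊥, isFGCon_bot, bot_le, (mapCon i ⊥).iseqv.refl a⟩,
        fun ⟨c, hc, hcx, h⟩ => ⟨c, hc, hcx, (mapCon i c).iseqv.symm h⟩, fun h h' => by
          obtain ⟨c, hc, hcx, h, h'⟩ := hdir h h'
          exact ⟨c, hc, hcx, (mapCon i c).iseqv.trans h h'⟩⟩
      inf := fun h h' => by
        obtain ⟨c, hc, hcx, h, h'⟩ := hdir h h'
        exact ⟨c, hc, hcx, (mapCon i c).inf h h'⟩
      sup := fun h h' => by
        obtain ⟨c, hc, hcx, h, h'⟩ := hdir h h'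
        exact ⟨c, hc, hcx, (mapCon i c).sup h h'⟩ }
  have he : comapCon i (principalCon x y) ≤ comapCon i e := fun a b hab =>
    ⟨principalCon a b, isFGCon_principal a b, principalCon_le_iff.2 hab, by
      rw [mapCon_principalCon]
      exact principalCon_rel _ _⟩
  obtain ⟨c, hc, hcx, h⟩ := hi.comapCon_le_iff.1 he (principalCon_rel x y)
  have hxc : comapCon i (principalCon x y) ≤ c := by
    rw [← hi.comapCon_mapCon c]
    exact (gc_mapCon i).monotone_u (principalCon_le_iff.2 h)
  rwa [le_antisymm hxc hcx]

theorem isFGCon_comapCon (hi : IsCongruencePreservingExtension i) {d : LatticeCon M}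
    (hd : IsFGCon d) : IsFGCon (comapCon i d) := by
  classical
  obtain ⟨s, rfl⟩ := hd
  induction s using Finset.induction_on with
  | empty => simpa [hi.comapCon_bot] using isFGCon_bot
  | insert p s _ ih =>
    rw [Finset.sup_insert, hi.comapCon_sup]
    exact (hi.isFGCon_comapCon_principalCon _ _).sup ih

/-- The restriction of compact congruences. -/
def restrictConC (hi : IsCongruencePreservingExtension i) : SupBotHom (ConC M) (ConC L) where
  toFun d := ⟨comapCon i d.1, hi.isFGCon_comapCon d.2⟩
  map_sup' d e := Subtype.ext (hi.comapCon_sup d.1 e.1)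
  map_bot' := Subtype.ext hi.comapCon_bot

/-- The distance on an extension `M` of `L` induced by a homomorphism defined on `L`. -/
def dist (hi : IsCongruencePreservingExtension i) {N : Type w} [Lattice N]
    (g : LatticeHom L N) : LatticeDist M (ConC N) :=
  ((LatticeDist.theta M).map ((mapConC g).comp hi.restrictConC))

theorem dist_apply (hi : IsCongruencePreservingExtension i) {N : Type w} [Lattice N]
    (g : LatticeHom L N) (x y : L) : (hi.dist g).dist (i x) (i y) = theta (g x) (g y) :=
  Subtype.ext (by
    change mapCon g (comapCon i (principalCon (i x) (i y))) = principalCon (g x) (g y)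
    rw [hi.comapCon_principalCon, mapCon_principalCon])

theorem dist_apply_eq_bot (hi : IsCongruencePreservingExtension i) {N : Type w} [Lattice N]
    (g : LatticeHom L N) (x y : L) : (hi.dist g).dist (i x) (i y) = ⊥ ↔ g x = g y := by
  rw [hi.dist_apply]
  exact (pregampOfLattice N).dist_eq_bot _ _

end IsCongruencePreservingExtension

/-- The restriction to `L` of the congruence generated by `(x, y)` is generated by finitely many
pairs of elements of `U`. -/
def IsGeneratedBy {L : Type u} {M : Type w} [Lattice L] [Lattice M] (i : LatticeHom L M)
    (U : Set L) (x y : M) : Prop :=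
  ∃ s : Finset (L × L), comapCon i (principalCon x y) = s.sup (fun p => principalCon p.1 p.2) ∧
    ∀ p ∈ s, p.1 ∈ U ∧ p.2 ∈ U

theorem mapCon_finset_sup {L : Type u} {M : Type w} [Lattice L] [Lattice M] (f : LatticeHom L M)
    {ι : Type*} (s : Finset ι) (a b : ι → L) :
    mapCon f (s.sup fun p => principalCon (a p) (b p)) =
      s.sup fun p => principalCon (f (a p)) (f (b p)) := by
  rw [Finset.apply_sup_eq_sup_comp (mapCon f) (fun _ _ => (gc_mapCon f).l_sup) (gc_mapCon f).l_bot]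
  exact Finset.sup_congr rfl fun p _ => mapCon_principalCon f (a p) (b p)

/-- Images of congruences preserve finite joins and principal congruences, so `g'` and `f ∘ g` need
only agree on the generators. This is what makes agreement on a finite set sufficient. -/
theorem IsGeneratedBy.dist_eq {L : Type u} {M N N' : Type w} [Lattice L] [Lattice M] [Lattice N]
    [Lattice N'] {i : LatticeHom L M} (hi : IsCongruencePreservingExtension i) {U : Set L}
    {x y : M} (h : IsGeneratedBy i U x y) {g : LatticeHom L N} {g' : LatticeHom L N'}
    {f : LatticeHom N N'} (hU : ∀ a ∈ U, g' a = f (g a)) :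
    (hi.dist g').dist x y = mapConC f ((hi.dist g).dist x y) := by
  obtain ⟨s, hs, hsU⟩ := h
  refine Subtype.ext ?_
  change mapCon g' (comapCon i (principalCon x y)) =
    mapCon f (mapCon g (comapCon i (principalCon x y)))
  rw [hs, mapCon_finset_sup, mapCon_finset_sup, mapCon_finset_sup]
  refine Finset.sup_congr rfl fun p hp => ?_
  rw [hU _ (hsU p hp).1, hU _ (hsU p hp).2]

/-! ### Recovering the pregamp of a lattice -/

/-- A lattice is recovered from representatives of its elements. -/
noncomputable def latticeIso {M N : Type u} [Lattice M] [Lattice N] {D : LatticeDist M (ConC N)}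
    {F K : Set M} (hK : D.OpClosed K) (hKF : K ⊆ F) (r : N → M) (hr : ∀ a, r a ∈ K)
    (hsurj : ∀ x ∈ K, ∃ a, D.dist (r a) x = ⊥)
    (hdist : ∀ a b, D.dist (r a) (r b) = theta a b)
    (hop : ∀ (l : LatOp) (a b : N), D.dist (l.eval (r a) (r b)) (r (l.eval a b)) = ⊥) :
    pregampOfLattice N ≅ (LatticeDist.gamp hK hKF).left :=
  let e : N → (LatticeDist.gamp hK hKF).left.carrier :=
    fun a => ⟨D.cls F (r a) (hKF (hr a)), r a, hr a, rfl⟩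
  have he : Function.Bijective e := by
    constructor
    · intro a b hab
      have h := D.cls_eq_cls.1 (congrArg Subtype.val hab)
      rw [hdist] at h
      exact ((pregampOfLattice N).dist_eq_bot a b).1 h
    · rintro ⟨_, x, hx, rfl⟩
      obtain ⟨a, ha⟩ := hsurj x hx
      exact ⟨a, Subtype.ext (D.cls_eq_cls.2 ha)⟩
  have hmem : ∀ (l : LatOp) (a b : N),
      e (l.eval a b) ∈ (LatticeDist.gamp hK hKF).left.palg.op l (e a) (e b) := fun l a b =>
    (@PartialSubalg.mem_op _ (D.palg F) (LatticeDist.clsSubalg hK hKF) l _ _ _).2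
      ⟨⟨⟨r a, hr a, rfl⟩, r b, hr b, rfl⟩, D.cls_mem_op.2 (hop l a b)⟩
  { hom :=
      { toFun := e
        semHom := SupBotHom.id _
        map_op := fun l a b c h => by
          obtain rfl := Part.mem_some_iff.1 h
          exact hmem l a b
        map_dist := fun a b => hdist a b }
    inv :=
      { toFun := (Equiv.ofBijective e he).symm
        semHom := SupBotHom.id _
        map_op := fun l x y z h => by
          obtain ⟨a, rfl⟩ := he.2 x
          obtain ⟨b, rfl⟩ := he.2 y
          obtain rfl := Part.mem_unique (hmem l a b) h
          simp only [Equiv.ofBijective_symm_apply_apply]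
          exact Part.mem_some _
        map_dist := fun x y => by
          obtain ⟨a, rfl⟩ := he.2 x
          obtain ⟨b, rfl⟩ := he.2 y
          simp only [Equiv.ofBijective_symm_apply_apply]
          exact (hdist a b).symm }
    hom_inv_id := Pregamp.Hom.ext (funext fun a => (Equiv.ofBijective e he).symm_apply_apply a) rfl
    inv_hom_id := Pregamp.Hom.ext (funext fun x => (Equiv.ofBijective e he).apply_symm_apply x) rfl }

/-! ### Projections of condensates -/

theorem exists_upper_bound_of_ideal {X : Type u} [PartialOrder X] (I : Order.Ideal X)
    (s : Finset X) : ∃ z ∈ I, ∀ w ∈ s, w ∈ I → w ≤ z := by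
  classical
  induction s using Finset.induction_on with
  | empty =>
    obtain ⟨z, hz⟩ := I.nonempty
    exact ⟨z, hz, fun w hw => absurd hw (Finset.notMem_empty w)⟩
  | insert x s _ ih =>
    obtain ⟨z, hz, hzs⟩ := ih
    by_cases hx : x ∈ I
    · obtain ⟨t, ht, hxt, hzt⟩ := I.directed x hx z hz
      refine ⟨t, ht, fun w hw hwI => ?_⟩
      rcases Finset.mem_insert.1 hw with rfl | hw
      · exact hxt
      · exact (hzs w hw hwI).trans hzt
    · refine ⟨z, hz, fun w hw hwI => ?_⟩
      rcases Finset.mem_insert.1 hw with rfl | hw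
      · exact absurd hwI hx
      · exact hzs w hw hwI

/-- Some `z` in `I` bounds the finite set `V ∩ I`; the largest element of `V` below `z` is the one
sought. -/
theorem IsKernel.exists_isGreatest {X : Type u} [PartialOrder X] {V : Finset X} (hV : IsKernel V)
    (I : Order.Ideal X) : ∃ v, IsGreatest {w | w ∈ V ∧ w ∈ I} v := by
  obtain ⟨z, hz, hzV⟩ := exists_upper_bound_of_ideal I V
  obtain ⟨v, hv⟩ := hV z
  exact ⟨v, ⟨hv.1.1, I.lower hv.1.2 hz⟩, fun w hw => hv.2 ⟨hw.1, hzV w hw.1 hw.2⟩⟩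

namespace NormCovering

variable {P : Type v} [PartialOrder P] {X : NormCovering.{u} P} {A : P ⥤ Lat.{w}}

theorem map_map_apply (A : P ⥤ Lat.{w}) {p q r : P} (h : p ≤ q) (h' : q ≤ r) (a : A.obj p) :
    (A.map (homOfLE h')).hom ((A.map (homOfLE h)).hom a) =
      (A.map (homOfLE (h.trans h'))).hom a := by
  rw [← Lat.comp_apply, ← A.map_comp]
  rfl

theorem map_refl_apply (A : P ⥤ Lat.{w}) {p : P} (h : p ≤ p) (a : A.obj p) :
    (A.map (homOfLE h)).hom a = a := by
  rw [show homOfLE h = 𝟙 p from rfl, A.map_id]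
  rfl

section

variable {I : Order.Ideal X.carrier} {p : P} (hp : ∀ w ∈ I, X.norm w ≤ p)

/-- The images in `A p` of the components of `t` at all large enough elements of `I` are `a`. -/
def IsEventualValue (t : ∀ x : X.carrier, A.obj (X.norm x)) (a : A.obj p) : Prop :=
  ∃ z ∈ I, ∀ (w : X.carrier) (hw : w ∈ I), z ≤ w → (A.map (homOfLE (hp w hw))).hom (t w) = a

theorem IsEventualValue.unique {t : ∀ x : X.carrier, A.obj (X.norm x)} {a b : A.obj p}
    (ha : IsEventualValue hp t a) (hb : IsEventualValue hp t b) : a = b := by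
  obtain ⟨y, hy, ha⟩ := ha
  obtain ⟨z, hz, hb⟩ := hb
  obtain ⟨w, hw, hyw, hzw⟩ := I.directed y hy z hz
  rw [← ha w hw hyw, ← hb w hw hzw]

theorem isEventualValue_of_isSupportedBy {t : ∀ x : X.carrier, A.obj (X.norm x)}
    {V : Finset X.carrier} (ht : X.IsSupportedBy A t V) {v : X.carrier}
    (hv : IsGreatest {w | w ∈ V ∧ w ∈ I} v) :
    IsEventualValue hp t ((A.map (homOfLE (hp v hv.1.2))).hom (t v)) := by
  refine ⟨v, hv.1.2, fun w hw hvw => ?_⟩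
  rw [ht w v ⟨⟨hv.1.1, hvw⟩, fun x hx => hv.2 ⟨hx.1, I.lower hx.2 hw⟩⟩, map_map_apply]

theorem exists_isEventualValue (t : X.condensate A) : ∃ a : A.obj p, IsEventualValue hp t.1 a := by
  obtain ⟨V, hV, ht⟩ := t.2
  obtain ⟨v, hv⟩ := hV.exists_isGreatest I
  exact ⟨_, isEventualValue_of_isSupportedBy hp ht hv⟩

/-- The projection of the condensate to `A p`, for an ideal whose members have norm at most `p`. -/
noncomputable def proj (A : P ⥤ Lat.{w}) {I : Order.Ideal X.carrier} {p : P}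
    (hp : ∀ w ∈ I, X.norm w ≤ p) : LatticeHom (X.condensate A) (A.obj p) where
  toFun t := (exists_isEventualValue hp t).choose
  map_sup' s t := by
    refine (exists_isEventualValue hp (s ⊔ t)).choose_spec.unique hp ?_
    obtain ⟨y, hy, hs⟩ := (exists_isEventualValue hp s).choose_spec
    obtain ⟨z, hz, ht⟩ := (exists_isEventualValue hp t).choose_spec
    obtain ⟨x, hx, hyx, hzx⟩ := I.directed y hy z hz
    refine ⟨x, hx, fun w hw hxw => ?_⟩
    rw [← hs w hw (hyx.trans hxw), ← ht w hw (hzx.trans hxw)]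
    exact map_sup _ _ _
  map_inf' s t := by
    refine (exists_isEventualValue hp (s ⊓ t)).choose_spec.unique hp ?_
    obtain ⟨y, hy, hs⟩ := (exists_isEventualValue hp s).choose_spec
    obtain ⟨z, hz, ht⟩ := (exists_isEventualValue hp t).choose_spec
    obtain ⟨x, hx, hyx, hzx⟩ := I.directed y hy z hz
    refine ⟨x, hx, fun w hw hxw => ?_⟩
    rw [← hs w hw (hyx.trans hxw), ← ht w hw (hzx.trans hxw)]
    exact map_inf _ _ _

theorem proj_eq_of_isSupportedBy {t : X.condensate A} {V : Finset X.carrier}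
    (ht : X.IsSupportedBy A t.1 V) {v : X.carrier} (hv : IsGreatest {w | w ∈ V ∧ w ∈ I} v) :
    proj A hp t = (A.map (homOfLE (hp v hv.1.2))).hom (t.1 v) :=
  (exists_isEventualValue hp t).choose_spec.unique hp (isEventualValue_of_isSupportedBy hp ht hv)

/-- Both projections are read off at the largest element of `V` in the respective ideal, and `hVI`
makes these two elements the same. -/
theorem map_proj_of_isSupportedBy {J : Order.Ideal X.carrier} {q : P}
    (hq : ∀ w ∈ J, X.norm w ≤ q) (hpq : p ≤ q) (hIJ : I ≤ J) {t : X.condensate A}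
    {V : Finset X.carrier} (hV : IsKernel V) (ht : X.IsSupportedBy A t.1 V)
    (hVI : ∀ v ∈ V, v ∈ J → v ∈ I) :
    proj A hq t = (A.map (homOfLE hpq)).hom (proj A hp t) := by
  obtain ⟨v, hv⟩ := hV.exists_isGreatest I
  have hv' : IsGreatest {w | w ∈ V ∧ w ∈ J} v :=
    ⟨⟨hv.1.1, hIJ hv.1.2⟩, fun w hw => hv.2 ⟨hw.1, hVI w hw.1 hw.2⟩⟩
  rw [proj_eq_of_isSupportedBy hp ht hv, proj_eq_of_isSupportedBy hq ht hv', map_map_apply]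

theorem proj_surjective (hne : ∀ p, Nonempty (A.obj p)) (hmem : ∃ w ∈ I, X.norm w = p) :
    Function.Surjective (proj A hp) := by
  classical
  intro a
  obtain ⟨w, hw, hwp⟩ := hmem
  obtain ⟨V, hwV, hV⟩ := X.supported {w}
  choose k hk using hV
  -- The value `a` is propagated wherever the norm allows; elsewhere an arbitrary value serves,
  -- since the kernel element that computes the projection lies above `w` and so has norm at least
  -- `p`.
  let b : ∀ x : X.carrier, A.obj (X.norm x) := fun x =>
    if h : p ≤ X.norm x then (A.map (homOfLE h)).hom a else (hne _).some
  let t : ∀ x : X.carrier, A.obj (X.norm x) := fun x =>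
    (A.map (homOfLE (X.norm.monotone (hk x).1.2))).hom (b (k x))
  have htb : ∀ (x v : X.carrier) (h : IsGreatest {w | w ∈ V ∧ w ≤ x} v),
      t x = (A.map (homOfLE (X.norm.monotone h.1.2))).hom (b v) := by
    intro x v h
    obtain rfl := h.unique (hk x)
    rfl
  have htV : ∀ v ∈ V, t v = b v := fun v hv => by
    rw [htb v v ⟨⟨hv, le_rfl⟩, fun _ hx => hx.2⟩, map_refl_apply]
  have ht : X.IsSupportedBy A t V := fun x v h => by
    rw [htb x v h, htV v h.1.1]
  obtain ⟨v, hv⟩ := IsKernel.exists_isGreatest (fun x => ⟨k x, hk x⟩) I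
  have hpv : p ≤ X.norm v :=
    hwp ▸ X.norm.monotone (hv.2 ⟨hwV (Finset.mem_singleton_self w), hw⟩)
  refine ⟨⟨t, V, fun x => ⟨k x, hk x⟩, ht⟩, ?_⟩
  rw [proj_eq_of_isSupportedBy hp ht hv]
  change (A.map _).hom (t v) = a
  rw [htV v hv.1.1, show b v = (A.map (homOfLE hpv)).hom a from dif_pos hpv, map_map_apply,
    map_refl_apply]

end

/-- Finitely many elements of the condensate are supported by a common kernel. -/
theorem exists_kernel_of_finite {U : Set (X.condensate A)} (hU : U.Finite) :
    ∃ V : Finset X.carrier, IsKernel V ∧ ∀ t ∈ U, X.IsSupportedBy A t.1 V := by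
  classical
  induction U, hU using Set.Finite.induction_on with
  | empty =>
    obtain ⟨V, -, hV⟩ := X.supported ∅
    exact ⟨V, hV, fun t ht => absurd ht (Set.notMem_empty t)⟩
  | insert _ _ ih =>
    rename_i t U _ _
    obtain ⟨V, hV, h⟩ := ih
    obtain ⟨W, hW, ht⟩ := t.2
    obtain ⟨Z, hZ, hZk⟩ := X.supported (V ∪ W)
    refine ⟨Z, hZk, fun s hs => ?_⟩
    rcases hs with rfl | hs
    · exact ht.mono hW (Finset.union_subset_right hZ)
    · exact (h s hs).mono hV (Finset.union_subset_left hZ)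

end NormCovering
/-! ### Diagrams of gamps in a congruence-preserving extension -/

/-- All transition maps are induced by inclusions `F p ⊆ F q` inside the one lattice `M`, so
functoriality is immediate on representatives. Only compatibility of the distances, `hcarries`, and
of the projections on representatives, `hcomm`, has to be supplied. -/
theorem exists_gamp_diagram {n : ℕ} {P : Type v} [PartialOrder P] (A : P ⥤ Lat.{u})
    {L M : Type u} [Lattice L] [Lattice M] {i : LatticeHom L M}
    (hi : IsCongruencePreservingExtension i) (g : ∀ p, LatticeHom L (A.obj p))
    (G : P → Set L) (F : P → Set M) (hsurj : ∀ p a, ∃ c ∈ G p, g p c = a)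
    (hGF : ∀ p, i '' G p ⊆ F p)
    (hchain : ∀ p, LatticeDist.HasMonotoneChains n (i '' G p) (F p))
    (hF : ∀ p q, p ≤ q → F p ⊆ F q)
    (hop : ∀ p q, p < q → ∀ (l : LatOp), ∀ x ∈ F p ∪ i '' G q, ∀ y ∈ F p ∪ i '' G q,
      l.eval x y ∈ F q)
    (hcomm : ∀ {p q} (f : p ⟶ q), ∀ c ∈ G p, g q c = (A.map f).hom (g p c))
    (hcarries : ∀ {p q} (f : p ⟶ q), LatticeDist.Carries (hi.dist (g p)) (hi.dist (g q))
      (mapConC (A.map f).hom) (F p)) :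
    ∃ 𝓑 : P ⥤ Gamp.{u},
      (∀ p, (𝓑.obj p).IsOfLattices ∧ (𝓑.obj p).LatticeCongruencePermutable n) ∧
      Gamp.IsOperationalDiagram 𝓑 ∧
      Nonempty (𝓑 ⋙ Gamp.PGGL ≅ A ⋙ PGA) := by
  have heval : ∀ (l : LatOp) (c d : L), l.eval (i c) (i d) = i (l.eval c d) := by
    rintro (_ | _) c d
    · exact (map_sup i c d).symm
    · exact (map_inf i c d).symm
  have hmap : ∀ (l : LatOp) p (c d : L), g p (l.eval c d) = l.eval (g p c) (g p d) := by
    rintro (_ | _) p c d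
    · exact map_sup (g p) c d
    · exact map_inf (g p) c d
  have hK : ∀ p, (hi.dist (g p)).OpClosed (i '' G p) := by
    rintro p l _ ⟨c, -, rfl⟩ _ ⟨d, -, rfl⟩
    obtain ⟨e, he, hec⟩ := hsurj p (g p (l.eval c d))
    exact ⟨i e, ⟨e, he, rfl⟩, by rw [heval, hi.dist_apply_eq_bot, hec]⟩
  have hKJ : ∀ p q, ∀ x ∈ i '' G p, ∃ y ∈ i '' G q, (hi.dist (g q)).dist y x = ⊥ := by
    rintro p q _ ⟨c, -, rfl⟩
    obtain ⟨e, he, hec⟩ := hsurj q (g q c)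
    exact ⟨i e, ⟨e, he, rfl⟩, (hi.dist_apply_eq_bot _ _ _).2 hec⟩
  choose r hrG hr using hsurj
  have hid : ∀ p, mapConC (A.map (𝟙 p)).hom = SupBotHom.id _ := fun p =>
    congrArg Pregamp.Hom.semHom ((A ⋙ PGA).map_id p)
  have hcomp : ∀ {p q s} (f : p ⟶ q) (f' : q ⟶ s), mapConC (A.map (f ≫ f')).hom =
      (mapConC (A.map f').hom).comp (mapConC (A.map f).hom) := fun f f' =>
    congrArg Pregamp.Hom.semHom ((A ⋙ PGA).map_comp f f')
  let 𝓑 : P ⥤ Gamp.{u} :=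
    { obj := fun p => LatticeDist.gamp (hK p) (hGF p)
      map := fun {p q} f => LatticeDist.gampMap (hcarries f) (hF p q (leOfHom f)) (hK p) (hGF p)
        (hK q) (hGF q) (hKJ p q)
      map_id := fun p => Gamp.Hom.ext (funext fun a => by
          obtain ⟨x, hx, rfl⟩ := LatticeDist.exists_cls _ a
          rfl)
        (hid p)
      map_comp := fun {p q s} f f' => Gamp.Hom.ext (funext fun a => by
          obtain ⟨x, hx, rfl⟩ := LatticeDist.exists_cls _ a
          rfl)
        (hcomp f f') }
  refine ⟨𝓑, fun p => ⟨LatticeDist.isOfLattices_gamp _ _,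
    LatticeDist.latticeCongruencePermutable_gamp _ _ (hchain p)⟩, fun p q h =>
    LatticeDist.isOperational_gampMap (hcarries _) (hF p q h.le) (hK p) (hGF p) (hK q) (hGF q)
      (hKJ p q) (hop p q h), ⟨Iso.symm ?_⟩⟩
  refine NatIso.ofComponents (fun p => latticeIso (hK p) (hGF p) (fun a => i (r p a))
    (fun a => ⟨r p a, hrG p a, rfl⟩) ?_ (fun a b => ?_) (fun l a b => ?_)) fun {p q} f => ?_
  · rintro _ ⟨c, -, rfl⟩
    exact ⟨g p c, (hi.dist_apply_eq_bot _ _ _).2 (hr p _)⟩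
  · rw [hi.dist_apply, hr, hr]
  · rw [heval, hi.dist_apply_eq_bot, hmap, hr, hr, hr]
  · refine Pregamp.Hom.ext (funext fun a => Subtype.ext (LatticeDist.cls_eq_cls _ |>.2 ?_)) rfl
    rw [hi.dist_apply_eq_bot]
    exact (hr q _).trans ((hcomm f _ (hrG p a)).trans (congrArg _ (hr p a))).symm

/-! ### Finite sets with monotone chains, closed step by step under the operations -/

section

variable {L : Type u} [Lattice L]

theorem LatticeDist.HasMonotoneChains.mono {n : ℕ} {K F G : Set L}
    (h : LatticeDist.HasMonotoneChains n K F) (hFG : F ⊆ G) :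
    LatticeDist.HasMonotoneChains n K G := fun x hx => by
  obtain ⟨y, hy, h⟩ := h x hx
  exact ⟨y, fun k hk => hFG (hy k hk), h⟩

theorem hasMonotoneChains_univ {n : ℕ} (hn : 0 < n) (hL : CongruencePermutable L n) (K : Set L) :
    LatticeDist.HasMonotoneChains n K Set.univ := fun x _ => by
  obtain ⟨y, hy, hy₀, hyn, h⟩ := exists_monotone_chain hn hL
    (((Finset.range n).filter fun i => Even i).sup fun i => principalCon (x i) (x (i + 1)))
    (((Finset.range n).filter fun i => Odd i).sup fun i => principalCon (x i) (x (i + 1))) x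
    fun i hi => (Nat.even_or_odd i).imp
      (fun h => principalCon_le_iff.1 (Finset.le_sup
        (f := fun i => principalCon (x i) (x (i + 1))) (by simp [hi, h])))
      (fun h => principalCon_le_iff.1 (Finset.le_sup
        (f := fun i => principalCon (x i) (x (i + 1))) (by simp [hi, h])))
  exact ⟨y, fun _ _ => Set.mem_univ _, hy, hy₀, hyn, fun k hk => (h k hk).2, fun k hk => (h k hk).1⟩

/-- Only the first `n + 1` terms of a sequence matter, so there are finitely many cases, each
contributing one finite chain. -/
theorem exists_finite_hasMonotoneChains {n : ℕ} (hn : 0 < n) (hL : CongruencePermutable L n)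
    {K : Set L} (hK : K.Finite) :
    ∃ F : Set L, F.Finite ∧ LatticeDist.HasMonotoneChains n K F := by
  have : Finite K := hK
  choose y _ hy using fun v : Fin (n + 1) → K => hasMonotoneChains_univ hn hL K
    (fun i => v ⟨min i n, by omega⟩) fun i _ => (v _).2
  refine ⟨⋃ v, y v '' Set.Iic n, Set.finite_iUnion fun v => (Set.finite_Iic n).image _,
    fun x hx => ?_⟩
  have hy := hy fun i => ⟨x i, hx i (by omega)⟩
  have hsup : ∀ (p : ℕ → Prop) [DecidablePred p],
      (((Finset.range n).filter fun i => p i).sup fun i =>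
        principalCon (x (min i n)) (x (min (i + 1) n))) =
      ((Finset.range n).filter fun i => p i).sup fun i => principalCon (x i) (x (i + 1)) := by
    intro p _
    refine Finset.sup_congr rfl fun i hi => ?_
    have hi : i < n := Finset.mem_range.1 (Finset.mem_filter.1 hi).1
    rw [min_eq_left hi.le, min_eq_left (Nat.succ_le_of_lt hi)]
  refine ⟨_, fun k hk => Set.mem_iUnion.2 ⟨_, k, hk, rfl⟩, hy.1, ?_, ?_,
    fun k hk h => ?_, fun k hk h => ?_⟩
  · simpa using hy.2.1
  · simpa using hy.2.2.1
  · rw [← hsup fun i => Even i]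
    exact hy.2.2.2.1 k hk h
  · rw [← hsup fun i => Odd i]
    exact hy.2.2.2.2 k hk h

/-- A set together with all values of the operations at its elements. -/
def opStep (T : Set L) : Set L := T ∪ {z | ∃ (l : LatOp), ∃ x ∈ T, ∃ y ∈ T, l.eval x y = z}

theorem subset_opStep (T : Set L) : T ⊆ opStep T := Set.subset_union_left

theorem eval_mem_opStep {T : Set L} (l : LatOp) {x y : L} (hx : x ∈ T) (hy : y ∈ T) :
    l.eval x y ∈ opStep T := Or.inr ⟨l, x, hx, y, hy, rfl⟩

theorem opStep_mono {T T' : Set L} (h : T ⊆ T') : opStep T ⊆ opStep T' := by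
  rintro z (hz | ⟨l, x, hx, y, hy, rfl⟩)
  · exact subset_opStep _ (h hz)
  · exact eval_mem_opStep l (h hx) (h hy)

theorem finite_opStep {T : Set L} (hT : T.Finite) : (opStep T).Finite := by
  refine hT.union (((hT.image2 (· ⊔ ·) hT).union (hT.image2 (· ⊓ ·) hT)).subset ?_)
  rintro z ⟨l, x, hx, y, hy, rfl⟩
  cases l
  · exact Or.inl ⟨x, hx, y, hy, rfl⟩
  · exact Or.inr ⟨x, hx, y, hy, rfl⟩

theorem opStep_iterate_mono {T T' : Set L} (h : T ⊆ T') {j k : ℕ} (hjk : j ≤ k) :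
    opStep^[j] T ⊆ opStep^[k] T' := by
  induction hjk with
  | refl =>
    induction j with
    | zero => exact h
    | succ j ih =>
      rw [Function.iterate_succ_apply', Function.iterate_succ_apply']
      exact opStep_mono ih
  | step _ ih =>
    rw [Function.iterate_succ_apply']
    exact ih.trans (subset_opStep _)

theorem finite_opStep_iterate {T : Set L} (hT : T.Finite) (k : ℕ) : (opStep^[k] T).Finite := by
  induction k with
  | zero => exact hT
  | succ k ih =>
    rw [Function.iterate_succ_apply']
    exact finite_opStep ih

/-- In a poset with all principal lower sets of non-maximal elements finite, finite sets can be
enlarged so as to increase and to absorb the values of the operations. -/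
theorem exists_absorbing_family {Y : Type w} [PartialOrder Y] (N : Y → Prop)
    (hN : ∀ x y, x ≤ y → N y → N x) (hfin : ∀ x, N x → {y | y ≤ x}.Finite)
    (T : Y → Set L) (hT : ∀ x, N x → (T x).Finite) :
    ∃ F : Y → Set L, (∀ x, T x ⊆ F x) ∧ (∀ x, N x → (F x).Finite) ∧
      ∀ x y, x < y → F x ⊆ F y ∧
        ∀ (l : LatOp), ∀ a ∈ F x ∪ T y, ∀ b ∈ F x ∪ T y, l.eval a b ∈ F y := by
  classical
  let U : Y → Set L := fun x => ⋃ y ∈ {y | y ≤ x}, T y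
  have hTU : ∀ x, T x ⊆ U x := fun x => Set.subset_biUnion_of_mem (u := T) (le_refl x)
  have hU : ∀ x y, x ≤ y → U x ⊆ U y := fun x y h =>
    Set.biUnion_subset_biUnion_left fun _ hz => le_trans hz h
  -- The number of elements below `x` serves as its rank. It grows strictly with `x`, so passing to
  -- a larger element allows at least one more round of operations.
  let F : Y → Set L := fun x => if N x then opStep^[{y | y ≤ x}.ncard] (U x) else Set.univ
  have hFN : ∀ x, N x → F x = opStep^[{y | y ≤ x}.ncard] (U x) := fun x h => if_pos h
  have hFn : ∀ x, ¬ N x → F x = Set.univ := fun x h => if_neg h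
  refine ⟨F, fun x => ?_, fun x hx => ?_, fun x y hxy => ?_⟩
  · by_cases hx : N x
    · rw [hFN x hx]
      exact (hTU x).trans (opStep_iterate_mono (Set.Subset.refl (U x)) (Nat.zero_le _))
    · rw [hFn x hx]
      exact Set.subset_univ _
  · rw [hFN x hx]
    exact finite_opStep_iterate ((hfin x hx).biUnion fun y hy => hT y (hN y x hy hx)) _
  · by_cases hy : N y
    · have hlt : {z | z ≤ x}.ncard < {z | z ≤ y}.ncard :=
        Set.ncard_lt_ncard (Set.ssubset_iff_of_subset (fun _ hz => le_trans hz hxy.le) |>.2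
          ⟨y, le_refl y, hxy.not_ge⟩) (hfin y hy)
      have hsub : F x ∪ T y ⊆ opStep^[{z | z ≤ x}.ncard] (U y) := by
        rw [hFN x (hN x y hxy.le hy)]
        exact Set.union_subset (opStep_iterate_mono (hU x y hxy.le) le_rfl)
          ((hTU y).trans (opStep_iterate_mono (Set.Subset.refl (U y)) (Nat.zero_le _)))
      rw [hFN y hy]
      refine ⟨(Set.subset_union_left.trans hsub).trans
        (opStep_iterate_mono (Set.Subset.refl _) hlt.le), fun l a ha b hb =>
        opStep_iterate_mono (Set.Subset.refl _) (Nat.succ_le_of_lt hlt) ?_⟩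
      rw [Function.iterate_succ_apply']
      exact eval_mem_opStep l (hsub ha) (hsub hb)
    · rw [hFn y hy]
      exact ⟨Set.subset_univ _, fun _ _ _ _ _ => Set.mem_univ _⟩

end

/-- Finitely many pairs, each with finitely many generators: this finite set is what a single kernel
must support. -/
theorem exists_finite_isGeneratedBy {L : Type u} {M : Type w} [Lattice L] [Lattice M]
    {i : LatticeHom L M} (hi : IsCongruencePreservingExtension i) {F : Set M} (hF : F.Finite) :
    ∃ U : Set L, U.Finite ∧ ∀ x ∈ F, ∀ y ∈ F, IsGeneratedBy i U x y := by
  choose s hs using fun x y => hi.isFGCon_comapCon_principalCon x y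
  refine ⟨⋃ x ∈ F, ⋃ y ∈ F, Prod.fst '' (s x y : Set (L × L)) ∪ Prod.snd '' (s x y : Set (L × L)),
    hF.biUnion fun x _ => hF.biUnion fun y _ =>
      ((s x y).finite_toSet.image _).union ((s x y).finite_toSet.image _),
    fun x hx y hy => ⟨s x y, hs x y, fun p hp => ?_⟩⟩
  simp only [Set.mem_iUnion]
  exact ⟨⟨x, hx, y, hy, Or.inl ⟨p, hp, rfl⟩⟩, ⟨x, hx, y, hy, Or.inr ⟨p, hp, rfl⟩⟩⟩

theorem NormCovering.SharpIdeal.norm_mono {P : Type v} [PartialOrder P] {X : NormCovering.{u} P}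
    {x y : X.SharpIdeal} (h : x ≤ y) : x.norm ≤ y.norm := by
  obtain ⟨w, hw, hwx⟩ := x.isGreatest_norm.1
  exact hwx ▸ y.isGreatest_norm.2 ⟨w, h hw, rfl⟩

end CondLift

/-! ### Choice of the finite data and of the section -/

theorem lemmaL (n : ℕ) (hn : 2 ≤ n) (𝒱 : LatticeVariety)
    {P : Type v} [PartialOrder P]
    (X : NormCovering.{u} P) (𝒳 : Set X.SharpIdeal) (hX : X.IsAlephZeroLifter 𝒳)
    (A : P ⥤ Lat.{u}) (hne : ∀ p, Nonempty (A.obj p)) (hA : ∀ p, 𝒱.Mem (A.obj p))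
    (hfin : ∀ p, ¬ IsMax p → Finite (A.obj p))
    (B : Type u) [Lattice B] (hB : CongruencePermutable B n)
    (i : LatticeHom (X.condensate A) B) (hi : IsCongruencePreservingExtension i) :
    ∃ 𝓑 : P ⥤ Gamp.{u},
      (∀ p, (𝓑.obj p).IsOfLattices ∧ (𝓑.obj p).LatticeCongruencePermutable n) ∧
      Gamp.IsOperationalDiagram 𝓑 ∧
      Nonempty (𝓑 ⋙ Gamp.PGGL ≅ A ⋙ PGA) := by
  classical
  have hn₀ : 0 < n := by omega
  have hG : ∀ x : 𝒳, ∃ G : Set (X.condensate A), (¬ IsMax x.1.norm → G.Finite) ∧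
      -- The norm is a variable with an equation because `σ p` will have norm `p` only
      -- propositionally; this avoids transport between lattices.
      ∀ p (hp : ∀ w ∈ x.1.1, X.norm w ≤ p), x.1.norm = p →
        ∀ a, ∃ c ∈ G, NormCovering.proj A hp c = a := by
    intro x
    have hsurj := NormCovering.proj_surjective (A := A)
      (fun w hw => x.1.isGreatest_norm.2 ⟨w, hw, rfl⟩) hne x.1.isGreatest_norm.1
    by_cases hx : IsMax x.1.norm
    · refine ⟨Set.univ, fun h => absurd hx h, ?_⟩
      rintro _ hp rfl a
      obtain ⟨c, hc⟩ := hsurj a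
      exact ⟨c, Set.mem_univ c, hc⟩
    · have := hfin _ hx
      choose r hr using hsurj
      refine ⟨Set.range r, fun _ => Set.finite_range r, ?_⟩
      rintro _ hp rfl a
      exact ⟨r a, ⟨a, rfl⟩, hr a⟩
  choose G hGfin hGsurj using hG
  have hT : ∀ x : 𝒳, ∃ T : Set B, (¬ IsMax x.1.norm → T.Finite) ∧ i '' G x ⊆ T ∧
      LatticeDist.HasMonotoneChains n (i '' G x) T := by
    intro x
    by_cases hx : IsMax x.1.norm
    · exact ⟨Set.univ, fun h => absurd hx h, Set.subset_univ _, hasMonotoneChains_univ hn₀ hB _⟩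
    · have hGx := (hGfin x hx).image i
      obtain ⟨T, hT, hTG⟩ := exists_finite_hasMonotoneChains hn₀ hB hGx
      exact ⟨i '' G x ∪ T, fun _ => hGx.union hT, Set.subset_union_left,
        hTG.mono Set.subset_union_right⟩
  choose T hTfin hGT hTchain using hT
  obtain ⟨F, hTF, hFfin, hF⟩ := exists_absorbing_family (fun x : 𝒳 => ¬ IsMax x.1.norm)
    (fun x y hxy hy hx => hy (hx.mono (NormCovering.SharpIdeal.norm_mono hxy)))
    (fun x hx => Set.Finite.of_finite_image
      ((hX.lower_finite x.1 x.2 hx).subset (by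
        rintro _ ⟨y, hy, rfl⟩
        exact ⟨y.2, hy⟩)) Subtype.val_injective.injOn) T hTfin
  -- `U` contains `G x`, for naturality of the isomorphism, and generators for distances on `opStep
  -- (F x)` rather than `F x`: a defined operation equals its value only up to distance zero, and
  -- that zero distance must survive transport.
  have hV : ∀ x : 𝒳, ∃ (V : Finset X.carrier) (U : Set (X.condensate A)), ¬ IsMax x.1.norm →
      IsKernel V ∧ (∀ t ∈ U, X.IsSupportedBy A t.1 V) ∧ G x ⊆ U ∧
      ∀ a ∈ opStep (F x), ∀ b ∈ opStep (F x), IsGeneratedBy i U a b := by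
    intro x
    by_cases hx : IsMax x.1.norm
    · exact ⟨∅, ∅, fun h => absurd hx h⟩
    · obtain ⟨U, hU, hUF⟩ := exists_finite_isGeneratedBy hi (finite_opStep (hFfin x hx))
      obtain ⟨V, hV, hVU⟩ := NormCovering.exists_kernel_of_finite ((hGfin x hx).union hU)
      refine ⟨V, G x ∪ U, fun _ => ⟨hV, hVU, Set.subset_union_left, fun a ha b hb => ?_⟩⟩
      obtain ⟨s, hs, hsU⟩ := hUF a ha b hb
      exact ⟨s, hs, fun p hp => ⟨Or.inr (hsU p hp).1, Or.inr (hsU p hp).2⟩⟩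
  choose V U hVU using hV
  -- Applied to the kernels, the lifter property says that those members of the kernel of `σ p`
  -- lying in `σ q` already lie in `σ p`, as `map_proj_of_isSupportedBy` requires.
  obtain ⟨σ, hσ𝒳, hσ, hσV⟩ := hX.exists_section fun x => if h : x ∈ 𝒳 then V ⟨x, h⟩ else ∅
  let τ : P → 𝒳 := fun p => ⟨σ p, hσ𝒳 p⟩
  have hτ : ∀ p q, p < q → τ p < τ q := fun p q h => lt_of_le_of_ne (σ.monotone h.le) fun e => by
    have := congrArg (fun x : 𝒳 => x.1.norm) e
    simp only [τ, hσ] at this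
    exact h.ne this
  have hnorm : ∀ p, ∀ w ∈ (σ p).1, X.norm w ≤ p := fun p w hw =>
    ((σ p).isGreatest_norm.2 ⟨w, hw, rfl⟩).trans (hσ p).le
  have hmax : ∀ p q, p < q → ¬ IsMax (τ p).1.norm := fun p q h hp => by
    simp only [τ, hσ] at hp
    exact hp.not_lt h
  have hcomm : ∀ p q (h : p < q), ∀ t ∈ U (τ p), NormCovering.proj A (hnorm q) t =
      (A.map (homOfLE h.le)).hom (NormCovering.proj A (hnorm p) t) := by
    intro p q h t ht
    obtain ⟨hker, hsupp, -, -⟩ := hVU (τ p) (hmax p q h)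
    refine NormCovering.map_proj_of_isSupportedBy (hnorm p) (hnorm q) h.le (σ.monotone h.le) hker
      (hsupp t ht) fun v hv hvq => hσV p q h v ?_ hvq
    rw [dif_pos (hσ𝒳 p)]
    exact hv
  refine exists_gamp_diagram A hi (fun p => NormCovering.proj A (hnorm p)) (fun p => G (τ p))
    (fun p => F (τ p)) (fun p => hGsurj (τ p) p (hnorm p) (hσ p))
    (fun p => (hGT (τ p)).trans (hTF (τ p))) (fun p => (hTchain (τ p)).mono (hTF (τ p)))
    (fun p q h => ?_) (fun p q h l x hx y hy => ?_) (fun {p q} f c hc => ?_) fun {p q} f => ?_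
  · rcases h.eq_or_lt with rfl | h
    · exact Set.Subset.refl _
    · exact (hF _ _ (hτ p q h)).1
  · exact (hF _ _ (hτ p q h)).2 l x (hx.imp_right fun h => hGT _ h) y
      (hy.imp_right fun h => hGT _ h)
  · rcases (leOfHom f).eq_or_lt with rfl | h
    · exact (NormCovering.map_refl_apply A (leOfHom f) _).symm
    · exact hcomm p q h c ((hVU (τ p) (hmax p q h)).2.2.1 hc)
  · rcases (leOfHom f).eq_or_lt with rfl | h
    · have hid : mapConC (A.map f).hom = SupBotHom.id _ :=
        congrArg Pregamp.Hom.semHom ((A ⋙ PGA).map_id p)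
      rw [hid]
      exact ⟨fun _ _ _ _ => rfl, fun _ _ _ _ _ _ _ => rfl⟩
    · have hgen := (hVU (τ p) (hmax p q h)).2.2.2
      exact ⟨fun x hx y hy => (hgen x (subset_opStep _ hx) y (subset_opStep _ hy)).dist_eq hi
          (hcomm p q h),
        fun l x hx y hy z hz => (hgen _ (eval_mem_opStep l hx hy) z (subset_opStep _ hz)).dist_eq hi
          (hcomm p q h)⟩
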